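/- **Setting.** Let $\mathcal X$ be a measurable space, $\mathcal Y=\{1,-1\}$, and let $\mathcal F$ be a class of measurable classifiers $f:\mathcal X\to\mathcal Y$ of finite VC dimension $d\ge 1$. For a probability measure $P$ on $\mathcal X\times\mathcal Y$ put $R(f)=P(f(X)\ne Y)$, $\eta(x)=\mathbb E[Y\mid X=x]$ and $f^*=\operatorname{sign}\eta$. For $h\in(0,1]$ let $\mathcal P(h,\mathcal F)$ be the set of all $P$ such that $f^*\in\mathcal F$ (up to a $P_X$-null set) and $|\eta(X)|\ge h$ almost surely. A learning algorithm is a (measurable) map that assigns to a sample of $n$ points of $\mathcal X\times\mathcal Y$ a classifier; it is an empirical risk minimizer (ERM) over $\mathcal F$ if on every sample its output lies in $\mathcal F$ and minimizes the number of errors on the sample among all $f\in\mathcal F$. Expectations are over an i.i.d. sample of size $n$ from $P$. **Local entropy.** For $x=(x_1,\dots,x_n)\in\mathcal X^n$ (repetitions allowed) let $\rho_x(f,g)=|\{i: f(x_i)\ne g(x_i)\}|$, let $B_x(f,r)=\{g\in\mathcal F:\rho_x(f,g)\le r\}$, and let $\mathcal M_x(H,\varepsilon)$ be the maximal size of a subset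 of $H$ whose distinct elements are at $\rho_x$-distance greater than $\varepsilon$. Put $$\mathcal M^{\mathrm{loc}}(\gamma,n,h)=\max_{x\in\mathcal X^n}\max_{f\in\mathcal F}\max_{\varepsilon\ge\gamma}\mathcal M_x\big(B_x(f,\varepsilon/h),\varepsilon/2\big),$$ $$\gamma^{\mathrm{loc}}_{h,h'}(n)=\max\{\gamma\in\mathbb N: h\gamma\le\log\mathcal M^{\mathrm{loc}}(\gamma,n,h')\},$$ where $\log t$ stands for $\ln(\max(t,e))$. For $c\ge1$, the class $\mathcal F$ is called $c$-pseudoconvex (at the margin $h$) if for every $N\ge1$ the maximum that defines $\mathcal M^{\mathrm{loc}}(\gamma^{\mathrm{loc}}_{h,1}(N),N,1)$ is attained at some radius $\varepsilon\le c\,\gamma^{\mathrm{loc}}_{h,1}(N)$. **Statement.** Let $0<C_0\le C_1<1$ and $c\ge 1$. There is a constant $K>0$ that depends only on $C_0$, $C_1$ and $c$ such that the following holds for all $\mathcal X$, $\mathcal F$, $d\ge1$, $n\ge1$ as above and all $h$ with $C_0\vee\sqrt{d/n}\le h\le C_1$ such that $\mathcal F$ is $c$-pseudoconvex (at the margin $h$).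 Put $$U=\frac{\gamma^{\mathrm{loc}}_{h,h}(n)}{n},\qquad L=\frac{d}{nh}+\frac1c\,\frac{(1-h)\,\gamma^{\mathrm{loc}}_{h,1}\big(\lceil \frac{nch}{1-h}\rceil\big)}{n}.$$ 1. For every ERM $\hat f$ over $\mathcal F$ and every $P\in\mathcal P(h,\mathcal F)$, $\ \mathbb E(R(\hat f)-R(f^*))\le K\,U$. 2. For every learning algorithm $\tilde f$ there is a $P\in\mathcal P(h,\mathcal F)$ with $\ \mathbb E(R(\tilde f)-R(f^*))\ge K^{-1}L$. 3. The two bounds match: $U\le K\,L$ and $L\le K\,U$. 4. Consequently every ERM $\hat f$ over $\mathcal F$ is minimax optimal up to a constant factor: $$\sup_{P\in\mathcal P(h,\mathcal F)}\mathbb E(R(\hat f)-R(f^*))\le K\inf_{\tilde f}\sup_{P\in\mathcal P(h,\mathcal F)}\mathbb E(R(\tilde f)-R(f^*)),$$ where the infimum is over all learning algorithms. -/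

import Mathlib

open MeasureTheory

noncomputable section

namespace LocalEntropy

/-- The label space `{1, -1}`, with `true` standing for `1` and `false` for `-1`. -/
abbrev Label := Bool

/-- The numerical value `±1` of a label. -/
def Label.val (y : Label) : ℝ := if y then 1 else -1

/-- The truncated logarithm `ln (max x e)`. -/
def tlog (x : ℝ) : ℝ := Real.log (max x (Real.exp 1))

section Combinatorics

variable {X : Type*}

/-- The finite set `s` is shattered by `F`: every labelling of `s` is realized in `F`. -/
def Shatters (F : Set (X → Label)) (s : Finset X) : Prop :=
  ∀ g : X → Label, ∃ f ∈ F, ∀ x ∈ s, f x = g x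

/-- `F` has (finite) VC dimension `d`. -/
def HasVCDim (F : Set (X → Label)) (d : ℕ) : Prop :=
  IsGreatest {k : ℕ | ∃ s : Finset X, s.card = k ∧ Shatters F s} d

/-- The Hamming distance of two classifiers on the points `x 0, …, x (n - 1)`
(repetitions are allowed). -/
def rhoH {n : ℕ} (x : Fin n → X) (f g : X → Label) : ℕ :=
  hammingDist (fun i => f (x i)) (fun i => g (x i))

/-- The Hamming ball `{g ∈ F | ρ_H(f, g) ≤ r}` with respect to the points `x`. -/
def hammingBall (F : Set (X → Label)) {n : ℕ} (x : Fin n → X) (f : X → Label) (r : ℝ) :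
    Set (X → Label) :=
  {g | g ∈ F ∧ (rhoH x f g : ℝ) ≤ r}

/-- The size of a maximal `ε`-packing of `H` in the distance `ρ_H` of the points `x`, that is of a
set of elements of `H` at pairwise distance greater than `ε`. It is at most `2 ^ n`
when `0 ≤ ε`. -/
def packingNumber (H : Set (X → Label)) {n : ℕ} (x : Fin n → X) (ε : ℝ) : ℕ :=
  sSup {k : ℕ | ∃ T : Finset (X → Label), (T : Set (X → Label)) ⊆ H ∧
    (∀ f ∈ T, ∀ g ∈ T, f ≠ g → ε < (rhoH x f g : ℝ)) ∧ T.card = k}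

/-- The worst-case local empirical packing number `M^loc_1(F, γ, n, h)`. -/
def localPacking (F : Set (X → Label)) (γ : ℝ) (n : ℕ) (h : ℝ) : ℕ :=
  sSup {k : ℕ | ∃ x : Fin n → X, ∃ f ∈ F, ∃ ε : ℝ, γ ≤ ε ∧
    packingNumber (hammingBall F x f (ε / h)) x (ε / 2) = k}

/-- The fixed point `γ^loc_{h, h'}(n, F)` of the local empirical entropy. -/
def fixedPoint (F : Set (X → Label)) (h h' : ℝ) (n : ℕ) : ℕ :=
  sSup {γ : ℕ | h * γ ≤ tlog (localPacking F γ n h')}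

/-- `F` is `c`-pseudoconvex at the margin `h`: for every `N`, the maximum that defines
`M^loc_1(F, γ, N, 1)` at the fixed point `γ = γ^loc_{h, 1}(N)` is attained at some radius
`ε ≤ c γ`. -/
def IsPseudoconvex (F : Set (X → Label)) (c h : ℝ) : Prop :=
  ∀ N : ℕ, 0 < N → ∃ ε : ℝ, (fixedPoint F h 1 N : ℝ) ≤ ε ∧ ε ≤ c * fixedPoint F h 1 N ∧
    ∃ x : Fin N → X, ∃ f ∈ F,
      packingNumber (hammingBall F x f (ε / 1)) x (ε / 2) =
        localPacking F (fixedPoint F h 1 N) N 1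

/-- The upper rate `γ^loc_{h, h}(n) / n`. -/
def upperRate (F : Set (X → Label)) (h : ℝ) (n : ℕ) : ℝ :=
  (fixedPoint F h h n : ℝ) / n

/-- The lower rate `d / (n h) + (1 / c) (1 - h) γ^loc_{h, 1}(⌈n c h / (1 - h)⌉) / n`. -/
def lowerRate (F : Set (X → Label)) (c h : ℝ) (d n : ℕ) : ℝ :=
  d / (n * h) + 1 / c * ((1 - h) * (fixedPoint F h 1 ⌈n * c * h / (1 - h)⌉₊ : ℝ) / n)

end Combinatorics

section Learning

variable {X : Type*} [MeasurableSpace X]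

/-- The risk `R(f) = P(f(X) ≠ Y)`. -/
def risk (P : ProbabilityMeasure (X × Label)) (f : X → Label) : ℝ :=
  (P : Measure (X × Label)).real {z | f z.1 ≠ z.2}

/-- The regression function `η(x) = E[Y | X = x]`, through the disintegration
`P = P_X × P_{Y|X}`. -/
def eta (P : ProbabilityMeasure (X × Label)) (x : X) : ℝ :=
  ∫ y, Label.val y ∂((P : Measure (X × Label)).condKernel x)

/-- The Bayes classifier `f^*(x) = sign (η(x))`, with `sign 0 = 1`. -/
def bayes (P : ProbabilityMeasure (X × Label)) (x : X) : Label :=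
  open Classical in decide (0 ≤ eta P x)

/-- The set `𝒫(h, F)` of the distributions that satisfy Massart's bounded noise condition with
margin `h`. The conditional law of `Y` given `X`, and so the Bayes classifier, is determined
`P_X`-almost everywhere only; `f^* ∈ F` is understood accordingly. -/
def massart (h : ℝ) (F : Set (X → Label)) : Set (ProbabilityMeasure (X × Label)) :=
  {P | (∃ f ∈ F, ∀ᵐ x ∂(P : Measure (X × Label)).fst, f x = bayes P x) ∧
    ∀ᵐ x ∂(P : Measure (X × Label)).fst, h ≤ |eta P x|}

/-- A (measurable) learning algorithm for samples of size `n`. It need not be proper. -/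
structure Learner (X : Type*) [MeasurableSpace X] (n : ℕ) where
  /-- The classifier that is output on a given sample. -/
  out : (Fin n → X × Label) → X → Label
  measurable_out : Measurable fun p : (Fin n → X × Label) × X => out p.1 p.2

/-- The empirical risk `R_n(f)`. -/
def empRisk {n : ℕ} (S : Fin n → X × Label) (f : X → Label) : ℝ :=
  ((Finset.univ.filter fun i => f (S i).1 ≠ (S i).2).card : ℝ) / n

/-- `A` is an empirical risk minimization algorithm over `F`. -/
def IsERM (F : Set (X → Label)) {n : ℕ} (A : Learner X n) : Prop :=
  ∀ S : Fin n → X × Label, A.out S ∈ F ∧ ∀ f ∈ F, empRisk S (A.out S) ≤ empRisk S f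

/-- The expected excess risk `E (R(f̃) - R(f^*))` of the output `f̃` of `A` on an i.i.d. sample
of size `n` from `P`. -/
def expectedExcess {n : ℕ} (P : ProbabilityMeasure (X × Label)) (A : Learner X n) : ℝ :=
  ∫ S, (risk P (A.out S) - risk P (bayes P))
    ∂(Measure.pi fun _ : Fin n => (P : Measure (X × Label)))

/-- The worst-case expected excess risk of `A` over `𝒫(h, F)`. -/
def worstExcess (h : ℝ) (F : Set (X → Label)) {n : ℕ} (A : Learner X n) : ENNReal :=
  ⨆ P ∈ massart h F, ENNReal.ofReal (expectedExcess P A)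

/-- The minimax expected excess risk over `𝒫(h, F)` for samples of size `n`. -/
def minimaxExcess (h : ℝ) (F : Set (X → Label)) (n : ℕ) : ENNReal :=
  ⨅ A : Learner X n, worstExcess h F A

end Learning

end LocalEntropy

end

noncomputable section

namespace LocalEntropy

/-! ### Packing numbers, the truncated logarithm and fixed points -/

section Combinatorics

variable {X : Type*}

/-! Write Γ for `fixedPoint F h 1 n`. Since h stays between C₀ and C₁, both rates U and L turn out
to be constant multiples of Γ / n, and the risk is bounded from both sides at this rate.

Comparison of rates. A maximal packing is a net, so above the scale Γ a ball can be covered by balls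
of half the radius at an entropy cost of order Γ. Iterated halving, products over blocks of points
and repetition of points carry this to comparable numbers of points and comparable scales
(`exists_hasNet`). Hence the fixed points at n, at multiples of n and at the margins h and 1 are
comparable (`exists_fixedPoint_le`). A discrete cube has no small nets, so d is at most of order Γ
as well (`exists_vcDim_le`), which takes care of the term d / (n h).

Upper bound (`exists_doubleDist_bound`, `exists_upper_bound`). Double the sample and let a random σ
select the half that the ERM sees. For a fixed design, a classifier at distance ρ from the Bayes
classifier makes no more errors than it on the selected half only with probability exponentially
small in h² ρ. A union bound over a net of each distance shell, with entropy of order Γ, leaves an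
expected distance of order Γ. The unselected half is independent of the output, so this distance
dominates n times the expected disagreement.

Lower bound (`exists_large_error`, `exists_lower_bound`). Put the uniform design on N = B n points
with B a large constant. Pseudoconvexity supplies a packing of a ball whose radius ε is comparable
with the fixed point at N, and whose log-cardinality is at least of that order. The sample meets on
average at most n ε / N disagreements between a member and the centre, too few to identify the
member, so some member costs an expected excess of order h ε / N. Comparing the fixed points at B n
and n returns the rate Γ / n. -/

lemma rhoH_eq_sum {n : ℕ} (x : Fin n → X) (f g : X → Label) :
    rhoH x f g = ∑ i, if f (x i) ≠ g (x i) then 1 else 0 := by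
  simp [rhoH, hammingDist, Finset.card_filter]

lemma rhoH_self {n : ℕ} (x : Fin n → X) (f : X → Label) : rhoH x f f = 0 := by
  simp [rhoH]

lemma rhoH_comm {n : ℕ} (x : Fin n → X) (f g : X → Label) : rhoH x f g = rhoH x g f :=
  hammingDist_comm _ _

lemma rhoH_triangle {n : ℕ} (x : Fin n → X) (f g k : X → Label) :
    (rhoH x f k : ℝ) ≤ rhoH x f g + rhoH x g k := by
  exact_mod_cast hammingDist_triangle _ _ _

lemma rhoH_le {n : ℕ} (x : Fin n → X) (f g : X → Label) : rhoH x f g ≤ n := by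
  simpa [rhoH] using hammingDist_le_card_fintype (x := fun i => f (x i)) (y := fun i => g (x i))

lemma card_le_of_separated {n : ℕ} (x : Fin n → X) {ε : ℝ} (hε : 0 ≤ ε)
    (T : Finset (X → Label)) (hT : ∀ f ∈ T, ∀ g ∈ T, f ≠ g → ε < (rhoH x f g : ℝ)) :
    T.card ≤ 2 ^ n := by
  have := Finset.card_le_card_of_injOn (s := T) (t := (Finset.univ : Finset (Fin n → Label)))
    (fun f i => f (x i)) (by simp) (by
      intro f hf g hg hfg
      by_contra hne
      have h1 := hT f hf g hg hne
      have h2 : rhoH x f g = 0 := by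
        simp only [rhoH, hammingDist_eq_zero]
        exact hfg
      rw [h2] at h1
      simp at h1
      linarith)
  simpa using this

lemma bddAbove_packing (H : Set (X → Label)) {n : ℕ} (x : Fin n → X) {ε : ℝ} (hε : 0 ≤ ε) :
    BddAbove {k : ℕ | ∃ T : Finset (X → Label), (T : Set (X → Label)) ⊆ H ∧
      (∀ f ∈ T, ∀ g ∈ T, f ≠ g → ε < (rhoH x f g : ℝ)) ∧ T.card = k} := by
  refine ⟨2 ^ n, ?_⟩
  rintro k ⟨T, -, hT, rfl⟩
  exact card_le_of_separated x hε T hT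

lemma le_packingNumber {H : Set (X → Label)} {n : ℕ} (x : Fin n → X) {ε : ℝ} (hε : 0 ≤ ε)
    {T : Finset (X → Label)} (hTH : (T : Set (X → Label)) ⊆ H)
    (hT : ∀ f ∈ T, ∀ g ∈ T, f ≠ g → ε < (rhoH x f g : ℝ)) :
    T.card ≤ packingNumber H x ε :=
  le_csSup (bddAbove_packing H x hε) ⟨T, hTH, hT, rfl⟩

lemma exists_packing (H : Set (X → Label)) {n : ℕ} (x : Fin n → X) {ε : ℝ} (hε : 0 ≤ ε) :
    ∃ T : Finset (X → Label), (T : Set (X → Label)) ⊆ H ∧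
      (∀ f ∈ T, ∀ g ∈ T, f ≠ g → ε < (rhoH x f g : ℝ)) ∧ T.card = packingNumber H x ε :=
  Nat.sSup_mem (s := {k : ℕ | ∃ T : Finset (X → Label), (T : Set (X → Label)) ⊆ H ∧
    (∀ f ∈ T, ∀ g ∈ T, f ≠ g → ε < (rhoH x f g : ℝ)) ∧ T.card = k})
    ⟨0, ∅, by simp, by simp, by simp⟩ (bddAbove_packing H x hε)

lemma packingNumber_le_two_pow (H : Set (X → Label)) {n : ℕ} (x : Fin n → X) {ε : ℝ}
    (hε : 0 ≤ ε) : packingNumber H x ε ≤ 2 ^ n := by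
  obtain ⟨T, -, hT, h⟩ := exists_packing H x hε
  exact h ▸ card_le_of_separated x hε T hT

lemma packingNumber_mono {H H' : Set (X → Label)} (hH : H ⊆ H') {n : ℕ} (x : Fin n → X) {ε : ℝ}
    (hε : 0 ≤ ε) : packingNumber H x ε ≤ packingNumber H' x ε := by
  obtain ⟨T, hTH, hT, h⟩ := exists_packing H x hε
  exact h ▸ le_packingNumber x hε (hTH.trans hH) hT

/-- A maximal packing is a net. -/
lemma exists_net (H : Set (X → Label)) {n : ℕ} (x : Fin n → X) {ε : ℝ} (hε : 0 ≤ ε) :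
    ∃ T : Finset (X → Label), (T : Set (X → Label)) ⊆ H ∧ T.card ≤ packingNumber H x ε ∧
      ∀ g ∈ H, ∃ t ∈ T, (rhoH x t g : ℝ) ≤ ε := by
  classical
  obtain ⟨T, hTH, hT, h⟩ := exists_packing H x hε
  refine ⟨T, hTH, h.le, fun g hg => ?_⟩
  by_contra! hcon
  have hgT : g ∉ T := fun hgT => by
    have := hcon g hgT
    rw [rhoH_self] at this
    simp at this
    linarith
  have := le_packingNumber (H := H) x hε (T := insert g T) (by
    intro f hf
    simp only [Finset.coe_insert, Set.mem_insert_iff, Finset.mem_coe] at hf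
    rcases hf with rfl | hf
    · exact hg
    · exact hTH hf) (by
    intro f hf k hk hne
    rw [Finset.mem_insert] at hf hk
    rcases hf with rfl | hf <;> rcases hk with rfl | hk
    · exact absurd rfl hne
    · rw [rhoH_comm]; exact hcon k hk
    · exact hcon f hf
    · exact hT f hf k hk hne)
  rw [Finset.card_insert_of_notMem hgT] at this
  omega

lemma le_localPacking {F : Set (X → Label)} {γ : ℝ} (hγ : 0 ≤ γ) {n : ℕ} (h : ℝ) (x : Fin n → X)
    {f : X → Label} (hf : f ∈ F) {ε : ℝ} (hε : γ ≤ ε) :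
    packingNumber (hammingBall F x f (ε / h)) x (ε / 2) ≤ localPacking F γ n h := by
  refine le_csSup ⟨2 ^ n, ?_⟩ ⟨x, f, hf, ε, hε, rfl⟩
  rintro k ⟨x, f, -, ε, hε, rfl⟩
  exact packingNumber_le_two_pow _ x (by linarith)

lemma localPacking_le {F : Set (X → Label)} {γ : ℝ} {n : ℕ} {h : ℝ} {L : ℕ}
    (hL : ∀ x : Fin n → X, ∀ f ∈ F, ∀ ε : ℝ, γ ≤ ε →
      packingNumber (hammingBall F x f (ε / h)) x (ε / 2) ≤ L) :
    localPacking F γ n h ≤ L := by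
  refine csSup_le' ?_
  rintro k ⟨x, f, hf, ε, hε, rfl⟩
  exact hL x f hf ε hε

lemma one_le_tlog (x : ℝ) : 1 ≤ tlog x := by
  rw [tlog, Real.le_log_iff_exp_le (by positivity)]
  exact le_max_right _ _

lemma tlog_mono {x y : ℝ} (h : x ≤ y) : tlog x ≤ tlog y :=
  Real.log_le_log (by positivity) (max_le_max h le_rfl)

lemma le_exp_tlog (x : ℝ) : x ≤ Real.exp (tlog x) := by
  rw [tlog, Real.exp_log (by positivity)]
  exact le_max_left _ _

lemma tlog_le {x y : ℝ} (h1 : 1 ≤ y) (h : x ≤ Real.exp y) : tlog x ≤ y := by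
  rw [tlog, Real.log_le_iff_le_exp (by positivity)]
  exact max_le h (Real.exp_le_exp.2 h1)

lemma bddAbove_fixedPoint (F : Set (X → Label)) {h : ℝ} (hh : 0 < h) (h' : ℝ) (n : ℕ) :
    BddAbove {γ : ℕ | h * γ ≤ tlog (localPacking F γ n h')} := by
  refine ⟨⌈tlog (2 ^ n) / h⌉₊, fun γ hγ => ?_⟩
  have h1 : (localPacking F γ n h' : ℝ) ≤ 2 ^ n := by
    have : localPacking F γ n h' ≤ 2 ^ n := localPacking_le fun x f _ ε hε =>
      packingNumber_le_two_pow _ x (by have : (0 : ℝ) ≤ γ := by positivity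
                                       linarith)
    exact_mod_cast this
  have h2 : (γ : ℝ) ≤ tlog (2 ^ n) / h := by
    rw [le_div_iff₀ hh, mul_comm]
    exact le_trans hγ (tlog_mono h1)
  exact_mod_cast h2.trans (Nat.le_ceil _)

lemma fixedPoint_spec (F : Set (X → Label)) {h : ℝ} (hh : 0 < h) (h' : ℝ) (n : ℕ) :
    h * (fixedPoint F h h' n : ℝ) ≤ tlog (localPacking F (fixedPoint F h h' n) n h') :=
  Nat.sSup_mem (s := {γ : ℕ | h * γ ≤ tlog (localPacking F γ n h')})
    ⟨0, by simpa using zero_le_one.trans (one_le_tlog _)⟩ (bddAbove_fixedPoint F hh h' n)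

lemma le_fixedPoint {F : Set (X → Label)} {h : ℝ} (hh : 0 < h) {h' : ℝ} {n γ : ℕ}
    (hγ : h * γ ≤ tlog (localPacking F γ n h')) : γ ≤ fixedPoint F h h' n :=
  le_csSup (bddAbove_fixedPoint F hh h' n) hγ

/-- The truncation of the logarithm at 1 admits γ = 1 when h ≤ 1. This lets Γ absorb additive
constants later on. -/
lemma one_le_fixedPoint (F : Set (X → Label)) {h : ℝ} (hh : 0 < h) (h1 : h ≤ 1) (h' : ℝ) (n : ℕ) :
    1 ≤ fixedPoint F h h' n :=
  le_fixedPoint hh (by simpa using h1.trans (one_le_tlog _))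

/-- A smaller margin enlarges the balls of radius ε / h', hence the packings inside them. Used to
bound Γ / n by U. -/
lemma fixedPoint_anti {F : Set (X → Label)} {h : ℝ} (hh : 0 < h) {h₁ h₂ : ℝ} (h0 : 0 < h₁)
    (h12 : h₁ ≤ h₂) (n : ℕ) : fixedPoint F h h₂ n ≤ fixedPoint F h h₁ n := by
  refine le_fixedPoint hh ((fixedPoint_spec F hh h₂ n).trans (tlog_mono ?_))
  have : localPacking F (fixedPoint F h h₂ n) n h₂ ≤ localPacking F (fixedPoint F h h₂ n) n h₁ := by
    refine localPacking_le fun x f hf ε hε => ?_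
    have hε0 : 0 ≤ ε := le_trans (by positivity) hε
    refine le_trans (packingNumber_mono ?_ x (by positivity))
      (le_localPacking (by positivity) h₁ x hf hε)
    rintro g ⟨hg, hr⟩
    exact ⟨hg, hr.trans (div_le_div_of_nonneg_left hε0 h0 h12)⟩
  exact_mod_cast this

/-! ### Nets, and comparison of fixed points -/

/-- Every Hamming ball of radius `r` in `F` on `n` points has an internal `s`-net of at most `L`
elements. -/
def HasNet (F : Set (X → Label)) (n : ℕ) (r s : ℝ) (L : ℕ) : Prop :=
  ∀ x : Fin n → X, ∀ f ∈ F, ∃ T : Finset (X → Label), (T : Set (X → Label)) ⊆ F ∧ T.card ≤ L ∧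
    ∀ g ∈ F, (rhoH x f g : ℝ) ≤ r → ∃ t ∈ T, (rhoH x t g : ℝ) ≤ s

lemma HasNet.mono {F : Set (X → Label)} {n : ℕ} {r r' s s' : ℝ} {L : ℕ} (H : HasNet F n r s L)
    (hr : r' ≤ r) (hs : s ≤ s') : HasNet F n r' s' L := by
  intro x f hf
  obtain ⟨T, hTF, hc, hT⟩ := H x f hf
  refine ⟨T, hTF, hc, fun g hg hfg => ?_⟩
  obtain ⟨t, ht, h⟩ := hT g hg (hfg.trans hr)
  exact ⟨t, ht, h.trans hs⟩

lemma HasNet.trans {F : Set (X → Label)} {n : ℕ} {r s s' : ℝ} {L L' : ℕ} (H : HasNet F n r s L)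
    (H' : HasNet F n s s' L') : HasNet F n r s' (L * L') := by
  classical
  intro x f hf
  obtain ⟨T, hTF, hc, hT⟩ := H x f hf
  choose! N hNF hNc hN using H' x
  refine ⟨T.biUnion N, ?_, ?_, fun g hg hfg => ?_⟩
  · intro g hg
    simp only [Finset.coe_biUnion, Set.mem_iUnion, Finset.mem_coe] at hg
    obtain ⟨t, ht, hg⟩ := hg
    exact hNF t (hTF ht) hg
  · refine (Finset.card_biUnion_le_card_mul T N L' fun t ht => hNc t (hTF ht)).trans ?_
    exact Nat.mul_le_mul_right _ hc
  · obtain ⟨t, ht, h⟩ := hT g hg hfg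
    obtain ⟨u, hu, h'⟩ := hN t (hTF ht) g hg h
    exact ⟨u, Finset.mem_biUnion.2 ⟨t, ht, hu⟩, h'⟩

lemma hasNet_localPacking (F : Set (X → Label)) (n : ℕ) {γ r : ℝ} (hγ : 0 ≤ γ) (hr : γ ≤ r) :
    HasNet F n r (r / 2) (localPacking F γ n 1) := by
  intro x f hf
  obtain ⟨T, hTF, hc, hT⟩ := exists_net (hammingBall F x f (r / 1)) x
    (ε := r / 2) (by linarith)
  refine ⟨T, fun g hg => (hTF hg).1, hc.trans (le_localPacking hγ 1 x hf hr), fun g hg hfg => ?_⟩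
  exact hT g ⟨hg, by simpa using hfg⟩

/-- Each halving costs one factor of the local packing number; the hypothesis keeps every halved
radius at or above γ. -/
lemma hasNet_pow (F : Set (X → Label)) (n : ℕ) {γ r : ℝ} (hγ : 0 ≤ γ) (j : ℕ)
    (hr : γ * 2 ^ j ≤ r) : HasNet F n r (r / 2 ^ j) (localPacking F γ n 1 ^ j) := by
  induction j with
  | zero =>
    intro x f hf
    exact ⟨{f}, by simpa using hf, by simp, fun g _ h => ⟨f, by simp, by simpa using h⟩⟩
  | succ j ih =>
    have h1 : γ * 2 ^ j ≤ r := by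
      have : 0 ≤ γ * 2 ^ j := by positivity
      rw [pow_succ] at hr
      linarith
    have h2 := (ih h1).trans (hasNet_localPacking F n hγ (r := r / 2 ^ j) (by
      rwa [le_div_iff₀ (by positivity)]))
    rw [pow_succ (localPacking F γ n 1)]
    exact h2.mono le_rfl (by rw [pow_succ, div_div])

lemma rhoH_eq_sum_blocks {k n : ℕ} (x : Fin (k * n) → X) (f g : X → Label) :
    rhoH x f g = ∑ j : Fin k, rhoH (fun i : Fin n => x (finProdFinEquiv (j, i))) f g := by
  simp only [rhoH_eq_sum]
  rw [← Fintype.sum_prod_type', ← finProdFinEquiv.sum_comp]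

/-- A ball of radius r on all points lies in a ball of radius r on each block, so tuples of block
centres cover it. Replacing a tuple by a single member of `F` doubles the error s per block, which
gives 2 k s. -/
lemma HasNet.blocks {F : Set (X → Label)} {n : ℕ} {r s : ℝ} {L : ℕ} (H : HasNet F n r s L)
    (k : ℕ) : HasNet F (k * n) r (2 * k * s) (L ^ k) := by
  classical
  intro x f hf
  set y : Fin k → Fin n → X := fun j i => x (finProdFinEquiv (j, i)) with hy
  choose T hTF hTc hT using fun j => H (y j) f hf
  -- A tuple of block centres need not come from one classifier. Pick a member of `F` close to the
  -- tuple on all blocks when there is one; otherwise the tuple covers nothing and `f` is a default.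
  have hrep : ∀ τ : Fin k → X → Label, ∃ u ∈ F, ∀ g ∈ F, (∀ j, (rhoH (y j) (τ j) g : ℝ) ≤ s) →
      ∀ j, (rhoH (y j) (τ j) u : ℝ) ≤ s := by
    intro τ
    by_cases hτ : ∃ g ∈ F, ∀ j, (rhoH (y j) (τ j) g : ℝ) ≤ s
    · obtain ⟨g, hg, h⟩ := hτ
      exact ⟨g, hg, fun _ _ _ => h⟩
    · exact ⟨f, hf, fun g hg h => absurd ⟨g, hg, h⟩ hτ⟩
  choose u huF hu using hrep
  refine ⟨(Fintype.piFinset T).image u, ?_, ?_, fun g hg hfg => ?_⟩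
  · intro g hg
    simp only [Finset.coe_image, Set.mem_image] at hg
    obtain ⟨τ, -, rfl⟩ := hg
    exact huF τ
  · refine Finset.card_image_le.trans ?_
    rw [Fintype.card_piFinset]
    simpa using Finset.prod_le_pow_card Finset.univ (fun j => (T j).card) L fun j _ => hTc j
  · have hj : ∀ j, ∃ t ∈ T j, (rhoH (y j) t g : ℝ) ≤ s := fun j => by
      refine hT j g hg (le_trans ?_ hfg)
      rw [rhoH_eq_sum_blocks x]
      exact_mod_cast Finset.single_le_sum (f := fun j => rhoH (y j) f g) (fun _ _ => Nat.zero_le _)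
        (Finset.mem_univ j)
    choose τ hτT hτ using hj
    refine ⟨u τ, Finset.mem_image_of_mem _ (Fintype.mem_piFinset.2 hτT), ?_⟩
    rw [rhoH_eq_sum_blocks x]
    push_cast
    calc ∑ j : Fin k, (rhoH (y j) (u τ) g : ℝ) ≤ ∑ j : Fin k, 2 * s := by
          refine Finset.sum_le_sum fun j _ => ?_
          have h1 := rhoH_triangle (y j) (u τ) (τ j) g
          rw [rhoH_comm _ (u τ) (τ j)] at h1
          linarith [hu τ g hg hτ j, hτ j]
      _ = 2 * k * s := by simp; ring

/-- Extend the N points cyclically to m points: each occurs at least once and at most a times, so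
every distance is multiplied by a factor between 1 and a. -/
lemma HasNet.of_repetition {F : Set (X → Label)} {N m a : ℕ} (hN : 0 < N) (hNm : N ≤ m)
    (hma : m ≤ a * N) {r s : ℝ} {L : ℕ} (H : HasNet F m (a * r) s L) : HasNet F N r s L := by
  intro x f hf
  set y : Fin m → X := fun i => x ⟨i % N, Nat.mod_lt _ hN⟩ with hy
  have h1 : ∀ f g, rhoH x f g ≤ rhoH y f g := fun f g => by
    unfold rhoH hammingDist
    refine Finset.card_le_card_of_injOn (Fin.castLE hNm) ?_ (Fin.castLE_injective hNm).injOn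
    intro i hi
    simpa [hy, Nat.mod_eq_of_lt i.2] using hi
  have h2 : ∀ f g, rhoH y f g ≤ rhoH x f g * a := fun f g => by
    have := Finset.card_le_card_of_injOn
      (s := Finset.univ.filter fun i => f (y i) ≠ g (y i))
      (t := (Finset.univ.filter fun i => f (x i) ≠ g (x i)) ×ˢ Finset.range a)
      (fun i => (⟨(i : ℕ) % N, Nat.mod_lt _ hN⟩, (i : ℕ) / N)) (by
        intro i hi
        simp only [Finset.coe_product, Set.mem_prod, Finset.mem_coe, Finset.mem_filter,
          Finset.mem_univ, true_and, Finset.mem_range]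
        refine ⟨by simpa [hy] using hi, ?_⟩
        rw [Nat.div_lt_iff_lt_mul hN]
        exact i.2.trans_le hma) (by
        intro i _ j _ hij
        simp only [Prod.mk.injEq, Fin.mk.injEq] at hij
        ext
        rw [← Nat.mod_add_div i N, ← Nat.mod_add_div j N, hij.1, hij.2])
    simpa [rhoH, hammingDist] using this
  obtain ⟨T, hTF, hc, hT⟩ := H y f hf
  refine ⟨T, hTF, hc, fun g hg hfg => ?_⟩
  obtain ⟨t, ht, h⟩ := hT g hg (by
    have : (rhoH y f g : ℝ) ≤ rhoH x f g * a := by exact_mod_cast h2 f g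
    refine this.trans ?_
    rw [mul_comm]
    gcongr)
  exact ⟨t, ht, le_trans (by exact_mod_cast h1 t g) h⟩

/-- Above the scale of the fixed point for `n` points, the balls on a comparable number of points
have nets whose entropy is at most a multiple of the fixed point. -/
theorem exists_hasNet (k a q : ℕ) (hk : 0 < k) (ha : 0 < a) (hq : 0 < q) :
    ∃ J : ℕ, 0 < J ∧ ∀ (X : Type*) (F : Set (X → Label)) (h : ℝ) (n N : ℕ), 0 < h → h ≤ 1 →
      0 < N → N ≤ k * n → k * n ≤ a * N → ∀ r : ℝ, (J * fixedPoint F h 1 n : ℝ) ≤ r →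
      ∃ L : ℕ, (L : ℝ) ≤ Real.exp (J * fixedPoint F h 1 n) ∧ HasNet F N r (r / q) L := by
  -- After j halvings of the radius a r, passing to k blocks leaves 2 k a r / 2 ^ j, which must be
  -- at most r / q.
  obtain ⟨j, hj⟩ : ∃ j : ℕ, 2 * k * a * q < 2 ^ j := ⟨_, Nat.lt_two_pow_self⟩
  -- The first summand is the entropy of j halvings on k blocks; the second keeps all halved radii
  -- above Γ + 1 ≤ 2 Γ.
  refine ⟨2 * j * k + 2 * 2 ^ j, by positivity, ?_⟩
  intro X F h n N hh h1 hN hNk hka r hr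
  set Γ := fixedPoint F h 1 n with hΓ
  have hΓ1 : (1 : ℝ) ≤ Γ := by exact_mod_cast one_le_fixedPoint F hh h1 1 n
  push_cast at hr
  have hr0 : 0 ≤ r := le_trans (by positivity) hr
  have ha1 : (1 : ℝ) ≤ a := by exact_mod_cast ha
  -- By maximality of Γ the defining inequality fails at Γ + 1, which bounds the packing number
  -- there from above.
  set M := localPacking F ((Γ + 1 : ℕ) : ℝ) n 1 with hM
  have hMexp : (M : ℝ) ≤ Real.exp (2 * Γ) := by
    have h2 : tlog M < h * (Γ + 1 : ℕ) := by
      by_contra! hcon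
      have := le_fixedPoint hh hcon
      omega
    refine (le_exp_tlog _).trans (Real.exp_le_exp.2 (h2.le.trans ?_))
    push_cast
    nlinarith
  refine ⟨(M ^ j) ^ k, ?_, ?_⟩
  · rw [← pow_mul]
    push_cast
    calc (M : ℝ) ^ (j * k) ≤ Real.exp (2 * Γ) ^ (j * k) := by gcongr
      _ = Real.exp (2 * j * k * Γ) := by rw [← Real.exp_nat_mul]; push_cast; ring_nf
      _ ≤ _ := by
        gcongr
        have : (0 : ℝ) ≤ 2 * 2 ^ j := by positivity
        linarith
  · have h3 : HasNet F n (a * r) (a * r / 2 ^ j) (M ^ j) := by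
      refine hasNet_pow F n (by positivity) j ?_
      push_cast
      have h4 : (Γ + 1 : ℝ) * 2 ^ j ≤ 2 * 2 ^ j * Γ := by
        have : (0 : ℝ) < 2 ^ j := by positivity
        nlinarith
      have h5 : (0 : ℝ) ≤ 2 * j * k * Γ := by positivity
      nlinarith
    refine (HasNet.of_repetition hN hNk hka (h3.blocks k)).mono le_rfl ?_
    have hj' : (2 * k * a * q : ℝ) ≤ 2 ^ j := by exact_mod_cast hj.le
    have hq' : (0 : ℝ) < q := by exact_mod_cast hq
    rw [le_div_iff₀ hq']
    calc 2 * k * (a * r / 2 ^ j) * q = (2 * k * a * q) * r / 2 ^ j := by ring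
      _ ≤ 2 ^ j * r / 2 ^ j := by gcongr
      _ = r := by field_simp

/-- Two elements served by the same centre are within 2 s ≤ ε, so a packing injects into the net. -/
lemma packingNumber_le_of_hasNet {F : Set (X → Label)} {n : ℕ} {r s ε : ℝ} {L : ℕ}
    (H : HasNet F n r s L) (hs : 2 * s ≤ ε) (hε : 0 ≤ ε) (x : Fin n → X) {f : X → Label}
    (hf : f ∈ F) : packingNumber (hammingBall F x f r) x ε ≤ L := by
  obtain ⟨S, hSH, hS, hcard⟩ := exists_packing (hammingBall F x f r) x hε
  obtain ⟨T, hTF, hc, hT⟩ := H x f hf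
  rw [← hcard]
  refine le_trans ?_ hc
  have hT' : ∀ g ∈ S, ∃ t ∈ T, (rhoH x t g : ℝ) ≤ s := fun g hg => hT g (hSH hg).1 (hSH hg).2
  choose! u huT hu using hT'
  refine Finset.card_le_card_of_injOn u huT ?_
  intro g hg g' hg' hgg
  by_contra hne
  have h1 := hS g hg g' hg' hne
  have h2 := rhoH_triangle x g (u g) g'
  rw [rhoH_comm x g (u g)] at h2
  have h3 := hu g' hg'
  rw [← hgg] at h3
  linarith [hu g hg]

/-- Fixed points for comparable numbers of points and comparable margins are comparable. -/
theorem exists_fixedPoint_le (k a : ℕ) (hk : 0 < k) (ha : 0 < a) (C₀ : ℝ) (hC₀ : 0 < C₀) :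
    ∃ K : ℝ, 0 < K ∧ ∀ (X : Type*) (F : Set (X → Label)) (h h' : ℝ) (n N : ℕ), C₀ ≤ h → h ≤ 1 →
      C₀ ≤ h' → h' ≤ 1 → 0 < N → N ≤ k * n → k * n ≤ a * N →
      (fixedPoint F h h' N : ℝ) ≤ K * fixedPoint F h 1 n := by
  -- Balls of radius ε / h' must be covered at radius at most ε / 4 to control packings at scale ε /
  -- 2; q ≥ 4 / C₀ ensures it.
  obtain ⟨q, hq⟩ := exists_nat_ge (4 / C₀)
  have hq0 : (0 : ℝ) < q := lt_of_lt_of_le (by positivity) hq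
  obtain ⟨J, hJ0, hJ⟩ := exists_hasNet k a q hk ha (by exact_mod_cast hq0)
  refine ⟨J + J / C₀, by positivity, ?_⟩
  intro X F h h' n N hh h1 hh' h1' hN hNk hka
  have hh0 : 0 < h := hC₀.trans_le hh
  have hh0' : 0 < h' := hC₀.trans_le hh'
  set Γ := fixedPoint F h 1 n with hΓ
  have hΓ1 : (1 : ℝ) ≤ Γ := by exact_mod_cast one_le_fixedPoint F hh0 h1 1 n
  have hJ1 : (1 : ℝ) ≤ J := by exact_mod_cast hJ0
  set G := fixedPoint F h h' N with hG
  -- If G exceeds J Γ, then so does every admissible radius; the nets then bound the packing number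
  -- at G by exp (J Γ), and the fixed point inequality gives h G ≤ J Γ.
  rcases le_total (G : ℝ) (J * Γ) with hle | hle
  · refine hle.trans ?_
    gcongr
    have : (0 : ℝ) ≤ J / C₀ := by positivity
    linarith
  have hM : (localPacking F G N h' : ℝ) ≤ Real.exp (J * Γ) := by
    have : localPacking F G N h' ≤ ⌊Real.exp (J * Γ)⌋₊ := by
      refine localPacking_le fun x f hf ε hε => ?_
      have hε0 : 0 ≤ ε := le_trans (by positivity) hε
      obtain ⟨L, hL, H⟩ := hJ X F h n N hh0 h1 hN hNk hka (ε / h') (by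
        rw [le_div_iff₀ hh0']
        nlinarith)
      refine (packingNumber_le_of_hasNet H ?_ (by positivity) x hf).trans (Nat.le_floor hL)
      have h4 : 4 ≤ h' * q := by
        rw [div_le_iff₀ hC₀] at hq
        nlinarith
      rw [div_div, mul_div_assoc', div_le_div_iff₀ (by positivity) two_pos]
      nlinarith
    exact (Nat.cast_le.2 this).trans (Nat.floor_le (by positivity))
  have h2 : h * G ≤ J * Γ := by
    refine (fixedPoint_spec F hh0 h' N).trans (tlog_le ?_ hM)
    nlinarith
  have h3 : (G : ℝ) ≤ J / C₀ * Γ := by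
    rw [div_mul_eq_mul_div, le_div_iff₀ hC₀]
    nlinarith
  nlinarith

/-- The exponential moment factorizes over coordinates. It limits how much of the cube one net
element can serve. -/
lemma sum_exp_neg_hammingDist (m : ℕ) (z : Fin m → Label) :
    ∑ y : Fin m → Label, Real.exp (-2 * hammingDist z y) = (1 + Real.exp (-2)) ^ m := by
  have h1 : ∀ y : Fin m → Label, Real.exp (-2 * hammingDist z y) =
      ∏ i, if z i ≠ y i then Real.exp (-2) else 1 := fun y => by
    rw [Finset.prod_ite]
    simp [hammingDist, ← Real.exp_nat_mul, mul_comm]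
  have h2 := Finset.prod_univ_sum (fun _ : Fin m => (Finset.univ : Finset Label))
    (fun i b => if z i ≠ b then Real.exp (-2) else 1)
  rw [Fintype.piFinset_univ] at h2
  simp only [h1]
  rw [← h2]
  have h3 : ∀ i, (∑ b : Label, if z i ≠ b then Real.exp (-2) else 1) = 1 + Real.exp (-2) := by
    intro i
    cases z i <;> simp [add_comm]
  rw [Finset.prod_congr rfl fun i _ => h3 i]
  simp

/-- The VC dimension is at most a multiple of the fixed point. -/
theorem exists_vcDim_le : ∃ K : ℝ, 0 < K ∧ ∀ (X : Type*) (F : Set (X → Label)) (h : ℝ) (n d : ℕ),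
    0 < h → h ≤ 1 → HasVCDim F d → 1 ≤ d → d ≤ n → (d : ℝ) ≤ K * fixedPoint F h 1 n := by
  classical
  obtain ⟨J, hJ0, hJ⟩ := exists_hasNet 1 1 16 one_pos one_pos (by norm_num)
  refine ⟨4 * J + 1, by positivity, ?_⟩
  intro X F h n d hh h1 hVC hd hdn
  set Γ := fixedPoint F h 1 n with hΓ
  have hΓ1 : (1 : ℝ) ≤ Γ := by exact_mod_cast one_le_fixedPoint F hh h1 1 n
  -- One shattered point is set aside to pad the design up to n points.
  obtain ⟨m, rfl⟩ : ∃ m, d = m + 1 := ⟨d - 1, by omega⟩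
  suffices hm : (m : ℝ) ≤ 4 * J * Γ by push_cast; nlinarith
  rcases le_total (m : ℝ) (J * Γ) with hle | hle
  · have : (0 : ℝ) ≤ J * Γ := by positivity
    linarith
  obtain ⟨s, hs, hsh⟩ := hVC.1
  obtain ⟨x₀, hx₀⟩ : s.Nonempty := Finset.card_pos.1 (by omega)
  have hcard : (s.erase x₀).card = m := by rw [Finset.card_erase_of_mem hx₀, hs]; simp
  set e : Fin m ≃ s.erase x₀ := ((s.erase x₀).equivFinOfCardEq hcard).symm with he
  -- All classifiers `G y` agree at the padding point x₀, so their mutual distances are at most m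
  -- and the ball of radius m contains the whole cube.
  set x : Fin n → X := fun i => if hi : (i : ℕ) < m then (e ⟨i, hi⟩ : X) else x₀ with hx
  have hG : ∀ y : Fin m → Label, ∃ g ∈ F, g x₀ = true ∧ ∀ i, g (e i) = y i := by
    intro y
    obtain ⟨g, hg, hgs⟩ := hsh fun z => if hz : z ∈ s.erase x₀ then y (e.symm ⟨z, hz⟩) else true
    refine ⟨g, hg, by rw [hgs x₀ hx₀]; simp, fun i => ?_⟩
    rw [hgs _ (Finset.mem_of_mem_erase (e i).2), dif_pos (e i).2]
    simp
  choose G hGF hG0 hG using hG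
  obtain ⟨L, hL, H⟩ := hJ X F h n n hh h1 (by omega) (by omega) (by omega) m hle
  obtain ⟨T, hTF, hTc, hT⟩ := H x (G fun _ => true) (hGF _)
  have hlow : ∀ (t : X → Label) (y : Fin m → Label),
      hammingDist (fun i => t (e i)) y ≤ rhoH x t (G y) := by
    intro t y
    unfold rhoH hammingDist
    refine Finset.card_le_card_of_injOn (Fin.castLE (by omega)) ?_
      (Fin.castLE_injective (by omega)).injOn
    intro i hi
    simpa [hx, hG] using hi
  have hup : ∀ y y' : Fin m → Label, rhoH x (G y) (G y') ≤ m := by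
    intro y y'
    have : ((Finset.univ.filter fun i : Fin n => (i : ℕ) < m)).card ≤ m := by
      have := Finset.card_le_card_of_injOn (s := Finset.univ.filter fun i : Fin n => (i : ℕ) < m)
        (t := Finset.range m) (fun i => (i : ℕ)) (fun i hi => by simpa using hi)
        (fun i _ j _ hij => Fin.ext hij)
      simpa using this
    unfold rhoH hammingDist
    refine le_trans (Finset.card_le_card fun i hi => ?_) this
    simp only [Finset.mem_filter, Finset.mem_univ, true_and] at hi ⊢
    by_contra hcon
    simp [hx, hcon, hG0] at hi
  -- Every vertex lies within m / 16 of some net element. Summing this bound over all vertices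
  -- forces the net to be exponentially large.
  have hpt : ∀ y : Fin m → Label, Real.exp (-2 * (m / 16)) ≤
      ∑ t ∈ T, Real.exp (-2 * hammingDist (fun i => t (e i)) y) := by
    intro y
    obtain ⟨t, ht, htr⟩ := hT (G y) (hGF y) (by exact_mod_cast hup _ _)
    refine le_trans (Real.exp_le_exp.2 ?_) (Finset.single_le_sum
      (f := fun t : X → Label => Real.exp (-2 * hammingDist (fun i => t (e i)) y))
      (fun _ _ => by positivity) ht)
    have : (hammingDist (fun i => t (e i)) y : ℝ) ≤ rhoH x t (G y) := by exact_mod_cast hlow t y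
    push_cast at htr
    linarith
  have hsum : (2 : ℝ) ^ m * Real.exp (-2 * (m / 16)) ≤ T.card * (1 + Real.exp (-2)) ^ m := by
    calc (2 : ℝ) ^ m * Real.exp (-2 * (m / 16))
        = ∑ _y : Fin m → Label, Real.exp (-2 * (m / 16)) := by simp
      _ ≤ ∑ y : Fin m → Label, ∑ t ∈ T, Real.exp (-2 * hammingDist (fun i => t (e i)) y) :=
          Finset.sum_le_sum fun y _ => hpt y
      _ = T.card * (1 + Real.exp (-2)) ^ m := by
          rw [Finset.sum_comm]
          rw [Finset.sum_congr rfl fun t _ => sum_exp_neg_hammingDist m fun i => t (e i)]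
          simp
  have he4 : Real.exp (-2) ≤ 1 / 4 := by
    have h1 : (2 : ℝ) ≤ Real.exp 1 := by linarith [Real.add_one_le_exp (1 : ℝ)]
    have h2 : Real.exp 2 = Real.exp 1 * Real.exp 1 := by rw [← Real.exp_add]; norm_num
    rw [Real.exp_neg, inv_le_comm₀ (by positivity) (by norm_num), h2]
    nlinarith
  have hfin : Real.exp (m * Real.log 2 + -2 * (m / 16)) ≤ Real.exp (J * Γ + m * (1 / 4)) := by
    calc Real.exp (m * Real.log 2 + -2 * (m / 16)) = 2 ^ m * Real.exp (-2 * (m / 16)) := by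
          rw [Real.exp_add, Real.exp_nat_mul, Real.exp_log two_pos]
      _ ≤ T.card * (1 + Real.exp (-2)) ^ m := hsum
      _ ≤ Real.exp (J * Γ) * Real.exp (1 / 4) ^ m := by
          gcongr
          · exact le_trans (by exact_mod_cast hTc) hL
          · linarith [Real.add_one_le_exp (1 / 4 : ℝ)]
      _ = _ := by rw [← Real.exp_nat_mul, Real.exp_add]
  rw [Real.exp_le_exp] at hfin
  -- log 2 - 1/8 - 1/4 exceeds 1/4, whence the factor 4.
  have := Real.log_two_gt_d9
  have hm0 : (0 : ℝ) ≤ m := by positivity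
  nlinarith

end Combinatorics

/-! ### Undecodability of small packings under noise -/

section LowerBound

variable {X : Type*}

/-- The probability of the label `b` at a point whose noiseless label is `a`. -/
def noiseWeight (h : ℝ) (a b : Label) : ℝ := if a = b then (1 + h) / 2 else (1 - h) / 2

lemma noiseWeight_nonneg {h : ℝ} (h0 : 0 ≤ h) (h1 : h ≤ 1) (a b : Label) :
    0 ≤ noiseWeight h a b := by
  unfold noiseWeight
  split_ifs <;> linarith

lemma sum_noiseWeight (h : ℝ) (a : Label) : ∑ b, noiseWeight h a b = 1 := by
  cases a <;> simp [noiseWeight] <;> ring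

/-- The likelihood ratio is 1 where the noiseless labels agree and at most (1 + h) / (1 - h) where
they differ. -/
lemma noiseWeight_le {h : ℝ} (h0 : 0 ≤ h) (h1 : h < 1) (a a' b : Label) :
    noiseWeight h a b ≤ (if a' ≠ a then (1 + h) / (1 - h) else 1) * noiseWeight h a' b := by
  have h2 : 0 < 1 - h := by linarith
  by_cases haa : a' = a
  · simp [haa]
  have h3 : (1 + h) / (1 - h) * ((1 - h) / 2) = (1 + h) / 2 := by field_simp
  have h4 : 1 ≤ (1 + h) / (1 - h) := by rw [one_le_div h2]; linarith
  have h5 : (1 - h) / 2 ≤ (1 + h) / (1 - h) * ((1 + h) / 2) := by nlinarith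
  rw [if_pos haa]
  unfold noiseWeight
  rcases eq_or_ne a b with hab | hab
  · rw [if_pos hab, if_neg (hab ▸ haa), h3]
  · have : a' = b := by
      cases a <;> cases a' <;> cases b <;> simp_all
    rw [if_neg hab, if_pos this]
    exact h5

/-- The probability of the sample `ω` when the points are drawn uniformly from `x` and labelled by
`g` with noise of margin `h`. -/
def sampleWeight {n N : ℕ} (h : ℝ) (x : Fin N → X) (g : X → Label) (ω : Fin n → Fin N × Label) :
    ℝ :=
  ∏ i, ((N : ℝ)⁻¹ * noiseWeight h (g (x (ω i).1)) (ω i).2)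

lemma sampleWeight_nonneg {n N : ℕ} {h : ℝ} (h0 : 0 ≤ h) (h1 : h ≤ 1) (x : Fin N → X)
    (g : X → Label) (ω : Fin n → Fin N × Label) : 0 ≤ sampleWeight h x g ω :=
  Finset.prod_nonneg fun _ _ => mul_nonneg (by positivity) (noiseWeight_nonneg h0 h1 _ _)

lemma sum_prod_noise {n N : ℕ} (h : ℝ) (x : Fin N → X) (g : X → Label) (v : Fin N → ℝ) :
    ∑ ω : Fin n → Fin N × Label, ∏ i, ((N : ℝ)⁻¹ * noiseWeight h (g (x (ω i).1)) (ω i).2 *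
      v (ω i).1) = ((N : ℝ)⁻¹ * ∑ k, v k) ^ n := by
  rw [← Fintype.sum_pow (fun z : Fin N × Label => (N : ℝ)⁻¹ * noiseWeight h (g (x z.1)) z.2 *
      v z.1), Fintype.sum_prod_type, Finset.mul_sum]
  congr 1
  refine Finset.sum_congr rfl fun k _ => ?_
  dsimp only
  rw [← Finset.sum_mul, ← Finset.mul_sum, sum_noiseWeight, mul_one]

lemma sum_sampleWeight {n N : ℕ} (hN : 0 < N) (h : ℝ) (x : Fin N → X) (g : X → Label) :
    ∑ ω : Fin n → Fin N × Label, sampleWeight h x g ω = 1 := by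
  have := sum_prod_noise (n := n) h x g fun _ => 1
  simp only [mul_one] at this
  unfold sampleWeight
  rw [this]
  have : (N : ℝ) ≠ 0 := by positivity
  simp [this]

/-- The number of sample points at which `f` and `g` disagree. -/
def disagreements {n N : ℕ} (x : Fin N → X) (f g : X → Label) (ω : Fin n → Fin N × Label) : ℕ :=
  (Finset.univ.filter fun i => f (x (ω i).1) ≠ g (x (ω i).1)).card

lemma exp_mul_disagreements {n N : ℕ} (x : Fin N → X) (f g : X → Label)
    (ω : Fin n → Fin N × Label) (s : ℝ) :
    Real.exp (s * disagreements x f g ω) =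
      ∏ i, if f (x (ω i).1) ≠ g (x (ω i).1) then Real.exp s else 1 := by
  rw [Finset.prod_ite]
  simp [disagreements, ← Real.exp_nat_mul, mul_comm]

/-- Change of measure from `g` to the centre `f`: the likelihood ratio is controlled by the number
of sampled disagreements alone. -/
lemma sampleWeight_le {n N : ℕ} {h : ℝ} (h0 : 0 ≤ h) (h1 : h < 1) (x : Fin N → X)
    (f g : X → Label) (ω : Fin n → Fin N × Label) :
    sampleWeight h x g ω ≤
      Real.exp (Real.log ((1 + h) / (1 - h)) * disagreements x f g ω) * sampleWeight h x f ω := by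
  have h2 : 0 < (1 + h) / (1 - h) := div_pos (by linarith) (by linarith)
  rw [exp_mul_disagreements, Real.exp_log h2, sampleWeight, sampleWeight,
    ← Finset.prod_mul_distrib]
  refine Finset.prod_le_prod (fun i _ => mul_nonneg (by positivity)
    (noiseWeight_nonneg h0 h1.le _ _)) fun i _ => ?_
  rw [mul_left_comm]
  exact mul_le_mul_of_nonneg_left (noiseWeight_le h0 h1 _ _ _) (by positivity)

/-- The number of disagreements is binomial with mean n ρ / N, so its exponential moment has a
Poisson-type bound. -/
lemma sum_sampleWeight_mul_exp_le {n N : ℕ} (hN : 0 < N) (h : ℝ) (x : Fin N → X)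
    (f g : X → Label) (s : ℝ) :
    ∑ ω : Fin n → Fin N × Label, sampleWeight h x g ω * Real.exp (s * disagreements x f g ω) ≤
      Real.exp (Real.exp s * (n * rhoH x f g / N)) := by
  have hN' : (0 : ℝ) < N := by exact_mod_cast hN
  simp only [exp_mul_disagreements, sampleWeight, ← Finset.prod_mul_distrib]
  rw [sum_prod_noise h x g fun k => if f (x k) ≠ g (x k) then Real.exp s else 1]
  have h1 : ∑ k, (if f (x k) ≠ g (x k) then Real.exp s else 1) ≤
      N + Real.exp s * rhoH x f g := by
    rw [rhoH_eq_sum]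
    push_cast
    rw [Finset.mul_sum]
    have : (N : ℝ) = ∑ _k : Fin N, 1 := by simp
    rw [this, ← Finset.sum_add_distrib]
    refine Finset.sum_le_sum fun k _ => ?_
    split_ifs <;> simp
  calc ((N : ℝ)⁻¹ * ∑ k, (if f (x k) ≠ g (x k) then Real.exp s else 1)) ^ n
      ≤ ((N : ℝ)⁻¹ * (N + Real.exp s * rhoH x f g)) ^ n := by
        have : 0 ≤ ∑ k, (if f (x k) ≠ g (x k) then Real.exp s else 1) :=
          Finset.sum_nonneg fun k _ => by split_ifs <;> positivity
        gcongr
    _ = (Real.exp s * rhoH x f g / N + 1) ^ n := by field_simp; ring_nf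
    _ ≤ Real.exp (Real.exp s * rhoH x f g / N) ^ n := by
        gcongr
        exact Real.add_one_le_exp _
    _ = _ := by rw [← Real.exp_nat_mul]; ring_nf

/-- A packing that is small compared with the resolution of the sample cannot be decoded. -/
lemma exists_large_error {n N : ℕ} (hN : 0 < N) (x : Fin N → X) {h : ℝ} (h0 : 0 < h) (h1 : h < 1)
    (f : X → Label) (T : Finset (X → Label)) (hT2 : 2 ≤ T.card) {ε : ℝ}
    (hball : ∀ g ∈ T, (rhoH x f g : ℝ) ≤ ε)
    (hsep : ∀ g ∈ T, ∀ g' ∈ T, g ≠ g' → ε / 2 < (rhoH x g g' : ℝ))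
    (hn : ((1 + h) / (1 - h)) ^ 6 * (n * ε / N) ≤ Real.log T.card)
    (out : (Fin n → Fin N × Label) → X → Label) :
    ∃ g ∈ T, ε / 100 ≤ ∑ ω, sampleWeight h x g ω * rhoH x (out ω) g := by
  set M : ℝ := (T.card : ℝ) with hM
  have hM2 : (2 : ℝ) ≤ M := by rw [hM]; exact_mod_cast hT2
  have hMpos : 0 < M := by linarith
  set Q := (1 + h) / (1 - h) with hQ
  have hQ1 : 1 < Q := by rw [hQ, one_lt_div (by linarith)]; linarith
  set l := Real.log Q with hl
  have hl0 : 0 < l := Real.log_pos hQ1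
  -- At t disagreements the likelihood ratio bound equals √M.
  set t := Real.log M / (2 * l) with ht
  have htl : l * t = Real.log M / 2 := by rw [ht]; field_simp
  have hN' : (0 : ℝ) < N := by exact_mod_cast hN
  have hTne : T.Nonempty := Finset.card_pos.1 (by omega)
  have hε : 0 ≤ ε := by
    obtain ⟨g, hg⟩ := hTne
    exact le_trans (by positivity) (hball g hg)
  set A : (X → Label) → (Fin n → Fin N × Label) → ℝ :=
    fun g ω => if (rhoH x (out ω) g : ℝ) ≤ ε / 4 then 1 else 0 with hA
  have hA0 : ∀ g ω, 0 ≤ A g ω := fun g ω => by simp only [hA]; split_ifs <;> norm_num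
  have hA1 : ∀ g ω, A g ω ≤ 1 := fun g ω => by simp only [hA]; split_ifs <;> norm_num
  -- The members are more than ε / 2 apart, so the output is within ε / 4 of at most one of them.
  have hdisj : ∀ ω, ∑ g ∈ T, A g ω ≤ 1 := by
    intro ω
    simp only [hA]
    rw [Finset.sum_boole]
    have : (T.filter fun g => (rhoH x (out ω) g : ℝ) ≤ ε / 4).card ≤ 1 := by
      rw [Finset.card_le_one]
      intro g hg g' hg'
      rw [Finset.mem_filter] at hg hg'
      by_contra hne
      have h2 := hsep g hg.1 g' hg'.1 hne
      have h3 := rhoH_triangle x g (out ω) g'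
      rw [rhoH_comm x g (out ω)] at h3
      linarith [hg.2, hg'.2]
    exact_mod_cast this
  -- Below t disagreements, change the measure to `f` at the price √M. Above t, exp (6 l D) is at
  -- least M ^ 3, so exponential Markov applies.
  have hpt : ∀ g ω, sampleWeight h x g ω * A g ω ≤
      Real.exp (Real.log M / 2) * (sampleWeight h x f ω * A g ω) +
        sampleWeight h x g ω * Real.exp (6 * l * disagreements x f g ω) *
          Real.exp (-(3 * Real.log M)) := by
    intro g ω
    have hwg := sampleWeight_nonneg h0.le h1.le x g ω
    have hwf := sampleWeight_nonneg h0.le h1.le x f ω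
    rcases le_total (disagreements x f g ω : ℝ) t with hD | hD
    · have h2 : sampleWeight h x g ω ≤ Real.exp (Real.log M / 2) * sampleWeight h x f ω := by
        refine (sampleWeight_le h0.le h1 x f g ω).trans ?_
        rw [← htl]
        gcongr
      have h3 : 0 ≤ sampleWeight h x g ω * Real.exp (6 * l * disagreements x f g ω) *
          Real.exp (-(3 * Real.log M)) := by positivity
      have h4 := mul_le_mul_of_nonneg_right h2 (hA0 g ω)
      linarith
    · have h2 : 1 ≤ Real.exp (6 * l * disagreements x f g ω) * Real.exp (-(3 * Real.log M)) := by
        rw [← Real.exp_add, ← Real.exp_zero]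
        apply Real.exp_le_exp.2
        nlinarith
      have h3 : 0 ≤ Real.exp (Real.log M / 2) * (sampleWeight h x f ω * A g ω) :=
        mul_nonneg (by positivity) (mul_nonneg hwf (hA0 g ω))
      have h4 : sampleWeight h x g ω * A g ω ≤ sampleWeight h x g ω :=
        mul_le_of_le_one_right hwg (hA1 g ω)
      have h5 : sampleWeight h x g ω ≤ sampleWeight h x g ω *
          Real.exp (6 * l * disagreements x f g ω) * Real.exp (-(3 * Real.log M)) := by
        rw [mul_assoc]
        exact le_mul_of_one_le_right hwg h2
      linarith
  have hexp : ∀ g ∈ T, ∑ ω : Fin n → Fin N × Label,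
      sampleWeight h x g ω * Real.exp (6 * l * disagreements x f g ω) ≤ M := by
    intro g hg
    refine (sum_sampleWeight_mul_exp_le hN h x f g _).trans ?_
    rw [← Real.le_log_iff_exp_le hMpos]
    refine le_trans ?_ hn
    have : Real.exp (6 * l) = Q ^ 6 := by
      rw [show (6 : ℝ) * l = ((6 : ℕ) : ℝ) * l by norm_num, Real.exp_nat_mul,
        Real.exp_log (by linarith)]
    rw [this]
    have := hball g hg
    gcongr
  have hM3 : Real.exp (-(3 * Real.log M)) = (M ^ 3)⁻¹ := by
    rw [Real.exp_neg, show (3 : ℝ) * Real.log M = ((3 : ℕ) : ℝ) * Real.log M by norm_num,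
      Real.exp_nat_mul, Real.exp_log hMpos]
  set u := Real.exp (Real.log M / 2) with hu
  have hu2 : u * u = M := by
    rw [hu, ← Real.exp_add, add_halves, Real.exp_log hMpos]
  have hu0 : 0 < u := Real.exp_pos _
  -- The successes sum to at most √M + 1 / M, which is at most 24 M / 25 for M ≥ 2. Some member thus
  -- fails with probability at least 1 / 25, at a distance above ε / 4; this is the constant 1 /
  -- 100.
  have htotal : ∑ g ∈ T, ∑ ω, sampleWeight h x g ω * A g ω ≤ ∑ _g ∈ T, (24 / 25 : ℝ) := by
    calc ∑ g ∈ T, ∑ ω, sampleWeight h x g ω * A g ω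
        ≤ ∑ g ∈ T, ∑ ω, (u * (sampleWeight h x f ω * A g ω) +
          sampleWeight h x g ω * Real.exp (6 * l * disagreements x f g ω) * (M ^ 3)⁻¹) := by
          refine Finset.sum_le_sum fun g _ => Finset.sum_le_sum fun ω _ => ?_
          rw [← hM3]
          exact hpt g ω
      _ = u * ∑ ω, sampleWeight h x f ω * ∑ g ∈ T, A g ω + ∑ g ∈ T, (∑ ω, sampleWeight h x g ω *
          Real.exp (6 * l * disagreements x f g ω)) * (M ^ 3)⁻¹ := by
          simp only [Finset.sum_add_distrib, ← Finset.mul_sum, ← Finset.sum_mul]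
          rw [Finset.sum_comm]
          simp only [Finset.mul_sum]
          rfl
      _ ≤ u * ∑ ω : Fin n → Fin N × Label, sampleWeight h x f ω * 1 +
          ∑ g ∈ T, M * (M ^ 3)⁻¹ := by
          gcongr with ω _ g hg
          · exact sampleWeight_nonneg h0.le h1.le x f ω
          · exact hdisj ω
          · exact hexp g hg
      _ = u + M⁻¹ := by
          simp only [mul_one, sum_sampleWeight hN, Finset.sum_const, nsmul_eq_mul, ← hM]
          field_simp
      _ ≤ M * (24 / 25) := by
          have h2 : M⁻¹ ≤ 1 / 2 := by
            rw [inv_le_comm₀ hMpos (by norm_num)]; linarith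
          have h3 : 1.414 ≤ u := by nlinarith
          nlinarith
      _ = _ := by simp [hM]
  obtain ⟨g, hg, hgA⟩ := Finset.exists_le_of_sum_le hTne htotal
  refine ⟨g, hg, ?_⟩
  have h2 : ∀ ω : Fin n → Fin N × Label, ε / 4 * (sampleWeight h x g ω -
      sampleWeight h x g ω * A g ω) ≤ sampleWeight h x g ω * rhoH x (out ω) g := by
    intro ω
    have hwg := sampleWeight_nonneg h0.le h1.le x g ω
    simp only [hA]
    split_ifs with hρ
    · rw [mul_one, sub_self, mul_zero]
      positivity
    · push Not at hρ
      nlinarith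
  calc ε / 100 ≤ ε / 4 * (1 - ∑ ω, sampleWeight h x g ω * A g ω) := by nlinarith
    _ = ∑ ω, ε / 4 * (sampleWeight h x g ω - sampleWeight h x g ω * A g ω) := by
        rw [← Finset.mul_sum, Finset.sum_sub_distrib, sum_sampleWeight hN]
    _ ≤ _ := Finset.sum_le_sum fun ω _ => h2 ω

end LowerBound

/-! ### Noisy uniform designs and the minimax lower bound -/

section NoisyDesign

section IndexLaw

variable {X : Type*}

/-- The law of the indices and labels of an observation. -/
def indexLaw {N : ℕ} (h : ℝ) (x : Fin N → X) (g : X → Label) : Measure (Fin N × Label) :=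
  ∑ z, ENNReal.ofReal ((N : ℝ)⁻¹ * noiseWeight h (g (x z.1)) z.2) • Measure.dirac z

lemma indexLaw_singleton {N : ℕ} (h : ℝ) (x : Fin N → X) (g : X → Label) (z : Fin N × Label) :
    indexLaw h x g {z} = ENNReal.ofReal ((N : ℝ)⁻¹ * noiseWeight h (g (x z.1)) z.2) := by
  simp only [indexLaw, Measure.finsetSum_apply, Measure.smul_apply, smul_eq_mul]
  rw [Finset.sum_eq_single z]
  · simp
  · intro w _ hw
    simp [hw]
  · simp

lemma isProbabilityMeasure_indexLaw {N : ℕ} (hN : 0 < N) {h : ℝ} (h0 : 0 ≤ h) (h1 : h ≤ 1)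
    (x : Fin N → X) (g : X → Label) : IsProbabilityMeasure (indexLaw h x g) := by
  constructor
  have hN' : (0 : ℝ) < N := by exact_mod_cast hN
  simp only [indexLaw, Measure.finsetSum_apply, Measure.smul_apply, measure_univ,
    smul_eq_mul, mul_one]
  rw [← ENNReal.ofReal_sum_of_nonneg fun z _ =>
    mul_nonneg (by positivity) (noiseWeight_nonneg h0 h1 _ _), Fintype.sum_prod_type]
  simp only [← Finset.mul_sum, sum_noiseWeight]
  simp [hN'.ne']

end IndexLaw

variable {X : Type*} [MeasurableSpace X]

open ProbabilityTheory

/-- The law of a label with noiseless value `a`. -/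
def noiseMeasure (h : ℝ) (a : Label) : Measure Label :=
  ∑ b, ENNReal.ofReal (noiseWeight h a b) • Measure.dirac b

lemma isProbabilityMeasure_noiseMeasure {h : ℝ} (h0 : 0 ≤ h) (h1 : h ≤ 1) (a : Label) :
    IsProbabilityMeasure (noiseMeasure h a) := by
  constructor
  simp only [noiseMeasure, Measure.finsetSum_apply, Measure.smul_apply, measure_univ,
    smul_eq_mul, mul_one]
  rw [← ENNReal.ofReal_sum_of_nonneg fun b _ => noiseWeight_nonneg h0 h1 a b, sum_noiseWeight,
    ENNReal.ofReal_one]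

lemma integral_val_noiseMeasure {h : ℝ} (h0 : 0 ≤ h) (h1 : h ≤ 1) (a : Label) :
    ∫ y, Label.val y ∂(noiseMeasure h a) = h * Label.val a := by
  have := isProbabilityMeasure_noiseMeasure h0 h1 a
  rw [integral_fintype .of_finite]
  have h2 : ∀ b, (noiseMeasure h a).real {b} = noiseWeight h a b := fun b => by
    rw [measureReal_def, noiseMeasure]
    cases b <;> simp [noiseWeight_nonneg h0 h1]
  simp only [h2]
  cases a <;> simp [noiseWeight, Label.val] <;> ring

/-- The conditional law of the label when the noiseless label is `g`. -/
def noiseKernel (h : ℝ) (g : X → Label) (hg : Measurable g) : Kernel X Label where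
  toFun x := noiseMeasure h (g x)
  measurable' := (Measurable.of_discrete (f := noiseMeasure h)).comp hg

/-- The uniform distribution on the points `x`, with multiplicities. -/
def design {N : ℕ} (x : Fin N → X) : Measure X :=
  ∑ k, ENNReal.ofReal (N : ℝ)⁻¹ • Measure.dirac (x k)

lemma isProbabilityMeasure_design {N : ℕ} (hN : 0 < N) (x : Fin N → X) :
    IsProbabilityMeasure (design x) := by
  constructor
  have hN' : (0 : ℝ) < N := by exact_mod_cast hN
  simp only [design, Measure.finsetSum_apply, Measure.smul_apply, measure_univ,
    smul_eq_mul, mul_one, Finset.sum_const, Finset.card_univ, Fintype.card_fin, nsmul_eq_mul]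
  rw [← ENNReal.ofReal_natCast, ← ENNReal.ofReal_mul (by positivity),
    mul_inv_cancel₀ hN'.ne', ENNReal.ofReal_one]

/-- The observation with given index and label. -/
def observe {N : ℕ} (x : Fin N → X) (z : Fin N × Label) : X × Label := (x z.1, z.2)

lemma measurable_observe {N : ℕ} (x : Fin N → X) : Measurable (observe x) := .of_discrete

lemma isMarkovKernel_noiseKernel {h : ℝ} (h0 : 0 ≤ h) (h1 : h ≤ 1) (g : X → Label)
    (hg : Measurable g) : IsMarkovKernel (noiseKernel h g hg) :=
  ⟨fun x => isProbabilityMeasure_noiseMeasure h0 h1 (g x)⟩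

/-- The disintegrated form identifies the regression function; the finitely supported form turns
risks and expectations into finite sums. -/
lemma compProd_design {N : ℕ} (hN : 0 < N) {h : ℝ} (h0 : 0 ≤ h) (h1 : h ≤ 1)
    (x : Fin N → X) (g : X → Label) (hg : Measurable g) :
    design x ⊗ₘ noiseKernel h g hg = (indexLaw h x g).map (observe x) := by
  have := isProbabilityMeasure_design hN x
  have := isMarkovKernel_noiseKernel h0 h1 g hg
  ext s hs
  rw [Measure.compProd_apply hs, Measure.map_apply (measurable_observe x) hs, design,
    lintegral_finsetSum_measure, indexLaw]
  simp only [lintegral_smul_measure, Measure.finsetSum_apply, Measure.smul_apply, smul_eq_mul]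
  rw [Fintype.sum_prod_type]
  refine Finset.sum_congr rfl fun k _ => ?_
  rw [lintegral_dirac' _ (Kernel.measurable_kernel_prodMk_left hs)]
  simp only [noiseKernel, Kernel.coe_mk, noiseMeasure, Measure.finsetSum_apply,
    Measure.smul_apply, smul_eq_mul, Finset.mul_sum]
  refine Finset.sum_congr rfl fun b _ => ?_
  rw [ENNReal.ofReal_mul (by positivity), mul_assoc,
    Measure.dirac_apply' _ (measurable_prodMk_left hs),
    Measure.dirac_apply' _ (measurable_observe x hs)]
  rfl

/-- The distribution with uniform design `x` whose labels are those of `g` with noise of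
margin `h`. -/
def noisyLaw {N : ℕ} (hN : 0 < N) {h : ℝ} (h0 : 0 ≤ h) (h1 : h ≤ 1) (x : Fin N → X)
    (g : X → Label) (hg : Measurable g) : ProbabilityMeasure (X × Label) :=
  ⟨design x ⊗ₘ noiseKernel h g hg, by
    have := isProbabilityMeasure_design hN x
    have := isMarkovKernel_noiseKernel h0 h1 g hg
    infer_instance⟩

section

variable {N : ℕ} (hN : 0 < N) {h : ℝ} (h0 : 0 ≤ h) (h1 : h ≤ 1) (x : Fin N → X) (g : X → Label)
  (hg : Measurable g)

lemma fst_noisyLaw : (noisyLaw hN h0 h1 x g hg : Measure (X × Label)).fst = design x := by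
  have := isProbabilityMeasure_design hN x
  have := isMarkovKernel_noiseKernel h0 h1 g hg
  exact Measure.fst_compProd _ _

lemma noisyLaw_eq_map :
    (noisyLaw hN h0 h1 x g hg : Measure (X × Label)) = (indexLaw h x g).map (observe x) :=
  compProd_design hN h0 h1 x g hg

lemma eta_noisyLaw :
    ∀ᵐ a ∂(noisyLaw hN h0 h1 x g hg : Measure (X × Label)).fst,
      eta (noisyLaw hN h0 h1 x g hg) a = h * Label.val (g a) := by
  have := isProbabilityMeasure_design hN x
  have := isMarkovKernel_noiseKernel h0 h1 g hg
  rw [fst_noisyLaw]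
  filter_upwards [condKernel_compProd (design x) (noiseKernel h g hg)] with a ha
  have h2 : (noisyLaw hN h0 h1 x g hg : Measure (X × Label)).condKernel a =
    noiseMeasure h (g a) := ha
  rw [eta, h2, integral_val_noiseMeasure h0 h1]

lemma bayes_noisyLaw (hpos : 0 < h) :
    ∀ᵐ a ∂(noisyLaw hN h0 h1 x g hg : Measure (X × Label)).fst,
      g a = bayes (noisyLaw hN h0 h1 x g hg) a := by
  filter_upwards [eta_noisyLaw hN h0 h1 x g hg] with a ha
  rw [bayes, ha]
  cases g a <;> simp [Label.val, hpos, hpos.le]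

lemma noisyLaw_mem_massart (hpos : 0 < h) {F : Set (X → Label)} (hgF : g ∈ F) :
    noisyLaw hN h0 h1 x g hg ∈ massart h F := by
  refine ⟨⟨g, hgF, bayes_noisyLaw hN h0 h1 x g hg hpos⟩, ?_⟩
  filter_upwards [eta_noisyLaw hN h0 h1 x g hg] with a ha
  rw [ha]
  cases g a <;> simp [Label.val, le_abs_self]

lemma risk_noisyLaw {f : X → Label} (hf : Measurable f) :
    risk (noisyLaw hN h0 h1 x g hg) f = (1 - h) / 2 + h * rhoH x f g / N := by
  have := isProbabilityMeasure_indexLaw hN h0 h1 x g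
  have hN' : (0 : ℝ) < N := by exact_mod_cast hN
  have hs : MeasurableSet {z : X × Label | f z.1 ≠ z.2} :=
    (measurableSet_eq_fun (hf.comp measurable_fst) measurable_snd).compl
  rw [risk, noisyLaw_eq_map, map_measureReal_apply (measurable_observe x) hs,
    ← integral_indicator_one (measurable_observe x hs), integral_fintype .of_finite]
  simp only [measureReal_def, indexLaw_singleton]
  rw [Fintype.sum_prod_type, rhoH_eq_sum]
  have h2 : ∀ k, ∑ b, (ENNReal.ofReal ((N : ℝ)⁻¹ * noiseWeight h (g (x k)) b)).toReal •
      (observe x ⁻¹' {z : X × Label | f z.1 ≠ z.2}).indicator (1 : Fin N × Label → ℝ) (k, b) =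
      (N : ℝ)⁻¹ * ((1 - h) / 2) + (N : ℝ)⁻¹ * (h * if f (x k) ≠ g (x k) then 1 else 0) := by
    intro k
    have h3 : ∀ b, (ENNReal.ofReal ((N : ℝ)⁻¹ * noiseWeight h (g (x k)) b)).toReal =
        (N : ℝ)⁻¹ * noiseWeight h (g (x k)) b := fun b =>
      ENNReal.toReal_ofReal (mul_nonneg (by positivity) (noiseWeight_nonneg h0 h1 _ _))
    simp only [h3, Set.indicator, observe, Set.mem_preimage, Set.mem_ofPred_eq]
    cases f (x k) <;> cases g (x k) <;> simp [noiseWeight] <;> ring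
  rw [Finset.sum_congr rfl fun k _ => h2 k, Finset.sum_add_distrib, ← Finset.mul_sum,
    ← Finset.mul_sum, ← Finset.mul_sum]
  push_cast
  simp only [Finset.sum_const, Finset.card_univ, Fintype.card_fin, nsmul_eq_mul]
  field_simp

lemma risk_congr_ae {P : ProbabilityMeasure (X × Label)} {f f' : X → Label}
    (hff : ∀ᵐ a ∂(P : Measure (X × Label)).fst, f a = f' a) : risk P f = risk P f' := by
  refine measureReal_congr ?_
  have := ae_of_ae_map measurable_fst.aemeasurable hff
  filter_upwards [this] with z hz
  simp only [eq_iff_iff]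
  show f z.1 ≠ z.2 ↔ f' z.1 ≠ z.2
  rw [hz]

lemma excess_noisyLaw (hpos : 0 < h) {f : X → Label} (hf : Measurable f) :
    risk (noisyLaw hN h0 h1 x g hg) f -
      risk (noisyLaw hN h0 h1 x g hg) (bayes (noisyLaw hN h0 h1 x g hg)) =
      h / N * rhoH x f g := by
  rw [← risk_congr_ae (bayes_noisyLaw hN h0 h1 x g hg hpos), risk_noisyLaw hN h0 h1 x g hg hf,
    risk_noisyLaw hN h0 h1 x g hg hg, rhoH_self]
  ring

lemma measurable_learner_out {n : ℕ} (A : Learner X n) (S : Fin n → X × Label) :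
    Measurable (A.out S) :=
  A.measurable_out.comp measurable_prodMk_left

/-- The sample is the image of a finite product space of indices and labels, where the integral is a
weighted sum. -/
lemma expectedExcess_noisyLaw (hpos : 0 < h) {n : ℕ} (A : Learner X n) :
    expectedExcess (noisyLaw hN h0 h1 x g hg) A =
      h / N * ∑ ω, sampleWeight h x g ω * rhoH x (A.out fun i => observe x (ω i)) g := by
  have := isProbabilityMeasure_indexLaw hN h0 h1 x g
  have hm : Measurable fun S => h / N * (rhoH x (A.out S) g : ℝ) := by
    simp only [rhoH_eq_sum]
    push_cast
    refine Measurable.const_mul (Finset.measurable_sum _ fun k _ => ?_) _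
    have h2 : Measurable fun S => A.out S (x k) := A.measurable_out.comp measurable_prodMk_right
    exact Measurable.ite (measurableSet_eq_fun h2 measurable_const).compl measurable_const
      measurable_const
  have hmp : MeasurePreserving (observe x) (indexLaw h x g)
      (noisyLaw hN h0 h1 x g hg : Measure (X × Label)) :=
    ⟨measurable_observe x, (noisyLaw_eq_map hN h0 h1 x g hg).symm⟩
  have hpi := measurePreserving_pi (fun _ : Fin n => indexLaw h x g)
    (fun _ : Fin n => (noisyLaw hN h0 h1 x g hg : Measure (X × Label))) fun _ => hmp
  unfold expectedExcess
  simp only [excess_noisyLaw hN h0 h1 x g hg hpos (measurable_learner_out A _)]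
  rw [← hpi.map_eq, integral_map hpi.measurable.aemeasurable hm.aestronglyMeasurable,
    integral_fintype .of_finite, Finset.mul_sum]
  refine Finset.sum_congr rfl fun ω _ => ?_
  have h2 : (Measure.pi fun _ : Fin n => indexLaw h x g).real {ω} = sampleWeight h x g ω := by
    rw [measureReal_def, Measure.pi_singleton, ENNReal.toReal_prod]
    refine Finset.prod_congr rfl fun i _ => ?_
    rw [indexLaw_singleton, ENNReal.toReal_ofReal]
    exact mul_nonneg (by positivity) (noiseWeight_nonneg h0 h1 _ _)
  rw [h2, smul_eq_mul]
  ring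

end

/-- The lower bound: no learner beats the fixed point of the local entropy on any larger multiple
of the sample size. -/
theorem exists_lower_bound (C₀ C₁ c : ℝ) (hC₀ : 0 < C₀) (hC₁ : C₁ < 1) (hc : 1 ≤ c) :
    ∃ B₀ : ℕ, 0 < B₀ ∧ ∀ B : ℕ, B₀ ≤ B → ∀ (X : Type*) [MeasurableSpace X] (F : Set (X → Label))
      (d n : ℕ) (h : ℝ), (∀ f ∈ F, Measurable f) → HasVCDim F d → 1 ≤ d → 0 < n → C₀ ≤ h →
      h ≤ C₁ → IsPseudoconvex F c h → ∀ A : Learner X n, ∃ P ∈ massart h F,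
        C₀ * fixedPoint F h 1 (B * n) / (100 * (B * n)) ≤ expectedExcess P A := by
  classical
  -- The first term makes the packing nontrivial; the second makes n ε / N small against the
  -- log-cardinality of the packing.
  obtain ⟨B₀, hB₀⟩ := exists_nat_ge (max (1 / C₀) (((1 + C₁) / (1 - C₁)) ^ 6 * (2 * c / C₀)) + 1)
  have hB1 : (0 : ℝ) < B₀ := by
    have := le_max_left (1 / C₀) (((1 + C₁) / (1 - C₁)) ^ 6 * (2 * c / C₀))
    have : 0 < 1 / C₀ := by positivity
    linarith
  refine ⟨B₀, by exact_mod_cast hB1, ?_⟩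
  intro B hB X _ F d n h hmeas hVC hd hn hh hh1 hpc A
  have hpos : 0 < h := hC₀.trans_le hh
  have hlt : h < 1 := hh1.trans_lt hC₁
  have hBB : (B₀ : ℝ) ≤ B := by exact_mod_cast hB
  have hn1 : (1 : ℝ) ≤ n := by exact_mod_cast hn
  have hBpos : (0 : ℝ) < B := hB1.trans_le hBB
  have hNpos : 0 < B * n := Nat.mul_pos (by exact_mod_cast hBpos) hn
  set N := B * n with hN
  have hNr : (N : ℝ) = B * n := by rw [hN]; push_cast; ring
  have hNr0 : (0 : ℝ) < N := by exact_mod_cast hNpos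
  set Γ := fixedPoint F h 1 N with hΓ
  have hΓ1 : (1 : ℝ) ≤ Γ := by exact_mod_cast one_le_fixedPoint F hpos hlt.le 1 N
  have hspec := fixedPoint_spec F hpos 1 N
  rw [← hΓ] at hspec
  -- Otherwise the truncated logarithm is 1 and Γ ≤ 1 / C₀ ≤ N. The radius N is then admissible, and
  -- the design that repeats one shattered point has two classifiers at distance N.
  have hM2 : 2 ≤ localPacking F Γ N 1 := by
    by_contra! hcon
    have hΓN : (Γ : ℝ) ≤ N := by
      have h2 : tlog (localPacking F Γ N 1) ≤ 1 := by
        refine tlog_le le_rfl ?_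
        have : (localPacking F Γ N 1 : ℝ) ≤ 1 := by exact_mod_cast Nat.lt_succ_iff.1 hcon
        linarith [Real.add_one_le_exp (1 : ℝ)]
      have h3 : C₀ * Γ ≤ 1 := by nlinarith
      have h4 : 1 ≤ C₀ * B := by
        have := le_max_left (1 / C₀) (((1 + C₁) / (1 - C₁)) ^ 6 * (2 * c / C₀))
        have h5 : 1 / C₀ ≤ B := by linarith
        rw [div_le_iff₀ hC₀] at h5
        linarith
      have h6 : (B : ℝ) ≤ N := by rw [hNr]; nlinarith
      by_contra! hlt
      nlinarith
    obtain ⟨s, hs, hsh⟩ := hVC.1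
    obtain ⟨x₀, hx₀⟩ : s.Nonempty := Finset.card_pos.1 (by omega)
    obtain ⟨f, hf, hfs⟩ := hsh fun _ => true
    obtain ⟨g, hg, hgs⟩ := hsh fun _ => false
    have hfg : rhoH (fun _ : Fin N => x₀) f g = N := by
      simp [rhoH_eq_sum, hfs x₀ hx₀, hgs x₀ hx₀]
    have hne : f ≠ g := fun h => by
      have := hfs x₀ hx₀
      rw [h, hgs x₀ hx₀] at this
      simp at this
    have h2 := le_packingNumber (H := hammingBall F (fun _ : Fin N => x₀) f ((N : ℝ) / 1))
      (fun _ : Fin N => x₀) (ε := (N : ℝ) / 2) (by positivity) (T := {f, g}) (by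
        intro k hk
        simp only [Finset.coe_insert, Finset.coe_singleton, Set.mem_insert_iff,
          Set.mem_singleton_iff] at hk
        rcases hk with rfl | rfl
        · exact ⟨hf, by rw [rhoH_self]; simp⟩
        · exact ⟨hg, by rw [hfg]; simp⟩) (by
        intro k hk k' hk' hkk
        simp only [Finset.mem_insert, Finset.mem_singleton] at hk hk'
        rcases hk with rfl | rfl <;> rcases hk' with rfl | rfl
        · exact absurd rfl hkk
        · rw [hfg]; linarith
        · rw [rhoH_comm, hfg]; linarith
        · exact absurd rfl hkk)
    rw [Finset.card_pair hne] at h2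
    have h3 := le_localPacking (F := F) (γ := Γ) (by positivity) 1 (fun _ : Fin N => x₀) hf
      (ε := N) hΓN
    omega
  -- Pseudoconvexity keeps ε ≤ c Γ; without it the sample could resolve the packing.
  obtain ⟨ε, hε1, hε2, x, f, hf, hpack⟩ := hpc N hNpos
  rw [← hΓ] at hε1 hε2 hpack
  obtain ⟨T, hTH, hTsep, hTc⟩ := exists_packing (hammingBall F x f (ε / 1)) x (ε := ε / 2)
    (by linarith)
  rw [hpack] at hTc
  have hT2 : 2 ≤ T.card := hTc ▸ hM2
  have hTr : (2 : ℝ) ≤ T.card := by exact_mod_cast hT2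
  -- Since 2 log 2 ≥ 1, the truncation costs a factor 2 at most.
  have hlogT : tlog T.card ≤ 2 * Real.log T.card := by
    refine tlog_le ?_ ?_
    · have := Real.log_le_log two_pos hTr
      linarith [Real.log_two_gt_d9]
    · rw [← Real.log_le_iff_le_exp (by linarith)]
      linarith [Real.log_pos (by linarith : (1 : ℝ) < T.card)]
  rw [← hTc] at hspec
  have hkey : ((1 + h) / (1 - h)) ^ 6 * (n * ε / N) ≤ Real.log T.card := by
    have hC1' : 0 < 1 - C₁ := by linarith
    have h2 : (1 + h) / (1 - h) ≤ (1 + C₁) / (1 - C₁) := by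
      rw [div_le_div_iff₀ (by linarith) hC1']
      nlinarith
    have h3 : n * ε / N ≤ c * Γ / B := by
      rw [hNr, div_le_div_iff₀ (by positivity) hBpos]
      have : 0 ≤ (B : ℝ) * n := by positivity
      nlinarith
    have h4 : C₀ * Γ ≤ 2 * Real.log T.card := by nlinarith
    have h5 : ((1 + C₁) / (1 - C₁)) ^ 6 * (2 * c / C₀) ≤ B := by
      have := le_max_right (1 / C₀) (((1 + C₁) / (1 - C₁)) ^ 6 * (2 * c / C₀))
      linarith
    set Q := ((1 + C₁) / (1 - C₁)) ^ 6 with hQ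
    have hQ0 : 0 ≤ Q := by
      rw [hQ]
      exact pow_nonneg (div_nonneg (by linarith) hC1'.le) 6
    calc ((1 + h) / (1 - h)) ^ 6 * (n * ε / N) ≤ Q * (c * Γ / B) := by
          have h6 : 0 ≤ n * ε / N := div_nonneg (mul_nonneg (by positivity) (by linarith)) hNr0.le
          have h7 : 0 ≤ (1 + h) / (1 - h) := div_nonneg (by linarith) (by linarith)
          have h8 : ((1 + h) / (1 - h)) ^ 6 ≤ Q := pow_le_pow_left₀ h7 h2 6
          gcongr
      _ = Q * (2 * c / C₀) * (C₀ * Γ / 2) / B := by field_simp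
      _ ≤ B * Real.log T.card / B := by
          have h8 : C₀ * Γ / 2 ≤ Real.log T.card := by linarith
          gcongr
      _ = Real.log T.card := by field_simp
  obtain ⟨g, hg, hlarge⟩ := exists_large_error hNpos x hpos hlt f T hT2
    (fun g hg => by simpa using (hTH hg).2) hTsep hkey
    (fun ω => A.out fun i => observe x (ω i))
  refine ⟨noisyLaw hNpos hpos.le hlt.le x g (hmeas g (hTH hg).1),
    noisyLaw_mem_massart hNpos hpos.le hlt.le x g _ hpos (hTH hg).1, ?_⟩
  rw [expectedExcess_noisyLaw hNpos hpos.le hlt.le x g _ hpos A]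
  calc C₀ * Γ / (100 * (B * n)) = C₀ / N * (Γ / 100) := by rw [hNr]; field_simp
    _ ≤ h / N * (ε / 100) := by gcongr
    _ ≤ _ := by gcongr

end NoisyDesign

/-! ### Random selection in the doubled sample -/

section Symmetrization

variable {X : Type*}

/-- The excess of the number of errors of `g` over that of `f` on the half of the doubled sample
that is selected by `σ`. -/
def selectedExcess {n : ℕ} (x : Fin n × Bool → X) (f g : X → Label) (σ : Fin n → Bool)
    (y : Fin n × Bool → Label) : ℝ :=
  ∑ i, ((if g (x (i, σ i)) ≠ y (i, σ i) then (1 : ℝ) else 0) -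
    if f (x (i, σ i)) ≠ y (i, σ i) then 1 else 0)

/-- The weight of a selection together with a labelling of the doubled sample. -/
def doubleWeight {n : ℕ} (w : Fin n × Bool → Label → ℝ) (y : Fin n × Bool → Label) : ℝ :=
  (1 / 2) ^ n * ∏ j, w j (y j)

/-- The number of points of the doubled sample at which two classifiers disagree. -/
def doubleDist {n : ℕ} (x : Fin n × Bool → X) (f g : X → Label) : ℕ :=
  (Finset.univ.filter fun j => f (x j) ≠ g (x j)).card

lemma doubleWeight_nonneg {n : ℕ} {w : Fin n × Bool → Label → ℝ} (hw0 : ∀ j b, 0 ≤ w j b)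
    (y : Fin n × Bool → Label) : 0 ≤ doubleWeight w y :=
  mul_nonneg (by positivity) (Finset.prod_nonneg fun j _ => hw0 j _)

/-- Integrating a product over the selected labels. -/
lemma sum_doubleWeight_mul_prod {n : ℕ} {w : Fin n × Bool → Label → ℝ}
    (hw1 : ∀ j, ∑ b, w j b = 1) (v : Fin n × Bool → Label → ℝ) :
    ∑ σ : Fin n → Bool, ∑ y : Fin n × Bool → Label,
      doubleWeight w y * ∏ i, v (i, σ i) (y (i, σ i)) =
      ∏ i, (1 / 2 * ∑ s, ∑ b, w (i, s) b * v (i, s) b) := by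
  have h1 : ∀ σ : Fin n → Bool, ∑ y : Fin n × Bool → Label,
      (∏ j, w j (y j)) * ∏ i, v (i, σ i) (y (i, σ i)) =
      ∏ i, ∑ b, w (i, σ i) b * v (i, σ i) b := by
    intro σ
    have h2 : ∀ y : Fin n × Bool → Label, (∏ j, w j (y j)) * ∏ i, v (i, σ i) (y (i, σ i)) =
        ∏ j : Fin n × Bool, w j (y j) * if j.2 = σ j.1 then v j (y j) else 1 := by
      intro y
      rw [Finset.prod_mul_distrib]
      congr 1
      rw [Fintype.prod_prod_type]
      simp
    have h3 := Finset.prod_univ_sum (fun _ : Fin n × Bool => (Finset.univ : Finset Label))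
      (fun j b => w j b * if j.2 = σ j.1 then v j b else 1)
    rw [Fintype.piFinset_univ] at h3
    rw [Finset.sum_congr rfl fun y _ => h2 y, ← h3, Fintype.prod_prod_type]
    refine Finset.prod_congr rfl fun i _ => ?_
    rw [Finset.prod_eq_single (σ i)]
    · simp
    · intro s _ hs
      simp only [if_neg hs, mul_one, hw1]
    · simp
  have h4 := Finset.prod_univ_sum (fun _ : Fin n => (Finset.univ : Finset Bool))
    (fun i s => ∑ b, w (i, s) b * v (i, s) b)
  rw [Fintype.piFinset_univ] at h4
  rw [Finset.prod_mul_distrib, h4]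
  simp only [doubleWeight, mul_assoc, ← Finset.mul_sum, h1]
  simp

lemma sum_doubleWeight {n : ℕ} {w : Fin n × Bool → Label → ℝ} (hw1 : ∀ j, ∑ b, w j b = 1) :
    ∑ _σ : Fin n → Bool, ∑ y : Fin n × Bool → Label, doubleWeight w y = 1 := by
  have := sum_doubleWeight_mul_prod hw1 fun _ _ => 1
  simp only [mul_one, Finset.prod_const_one, hw1] at this
  rw [this]
  simp

/-- By exp u ≤ 1 + u + u² at u = ± h / 2, the linear term gains at least h² / 2 and the quadratic
term loses h² / 4. -/
lemma label_mgf_le {h p p' : ℝ} (h0 : 0 ≤ h) (h1 : h ≤ 1) (hp : 0 ≤ p) (hp' : 0 ≤ p')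
    (hsum : p + p' = 1) (hm : h ≤ p - p') :
    p * Real.exp (-(h / 2)) + p' * Real.exp (h / 2) ≤ 1 - h ^ 2 / 4 := by
  have e1 := Real.abs_exp_sub_one_sub_id_le (x := h / 2) (by rw [abs_of_nonneg] <;> linarith)
  have e2 := Real.abs_exp_sub_one_sub_id_le (x := -(h / 2))
    (by rw [abs_neg, abs_of_nonneg] <;> linarith)
  have e1' := (abs_le.1 e1).2
  have e2' := (abs_le.1 e2).2
  nlinarith [mul_le_mul_of_nonneg_left e1' hp', mul_le_mul_of_nonneg_left e2' hp]

/-- Averaging over σ charges each point of a pair with probability 1 / 2, so disagreements in both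
halves contribute, with h² / 8 in place of h² / 4. -/
lemma sum_doubleWeight_mul_exp_le {n : ℕ} {w : Fin n × Bool → Label → ℝ} {h : ℝ} (h0 : 0 ≤ h)
    (h1 : h ≤ 1) (hw0 : ∀ j b, 0 ≤ w j b) (hw1 : ∀ j, ∑ b, w j b = 1) (x : Fin n × Bool → X)
    (f g : X → Label) (hm : ∀ j, h ≤ w j (f (x j)) - w j (!f (x j))) :
    ∑ σ : Fin n → Bool, ∑ y : Fin n × Bool → Label,
      doubleWeight w y * Real.exp (-(h / 2) * selectedExcess x f g σ y) ≤
      Real.exp (-(h ^ 2 / 8 * doubleDist x f g)) := by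
  set v : Fin n × Bool → Label → ℝ := fun j b => Real.exp (-(h / 2) *
    ((if g (x j) ≠ b then (1 : ℝ) else 0) - if f (x j) ≠ b then 1 else 0)) with hv
  have hprod : ∀ (σ : Fin n → Bool) (y : Fin n × Bool → Label),
      Real.exp (-(h / 2) * selectedExcess x f g σ y) = ∏ i, v (i, σ i) (y (i, σ i)) := by
    intro σ y
    rw [selectedExcess, Finset.mul_sum, Real.exp_sum]
  simp only [hprod]
  rw [sum_doubleWeight_mul_prod hw1]
  have hone : ∀ j, ∑ b, w j b * v j b ≤ 1 - h ^ 2 / 4 * if f (x j) ≠ g (x j) then 1 else 0 := by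
    intro j
    have hs := hw1 j
    have hmj := hm j
    by_cases hfg : f (x j) = g (x j)
    · simp [hv, hfg] at hs ⊢
      linarith
    · rw [if_pos hfg, mul_one]
      have hg : g (x j) = !f (x j) := by
        revert hfg
        cases f (x j) <;> cases g (x j) <;> simp
      refine le_trans (le_of_eq ?_) (label_mgf_le h0 h1 (hw0 j (f (x j))) (hw0 j (!f (x j))) ?_ hmj)
      · simp only [hv, hg]
        cases f (x j) <;> simp [add_comm]
      · revert hs
        cases f (x j) <;> simp [add_comm]
  have hcard : (doubleDist x f g : ℝ) =
      ∑ i : Fin n, ∑ s : Bool, if f (x (i, s)) ≠ g (x (i, s)) then (1 : ℝ) else 0 := by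
    rw [doubleDist, Finset.card_filter, Fintype.sum_prod_type]
    push_cast
    rfl
  rw [hcard, Finset.mul_sum, ← Finset.sum_neg_distrib, Real.exp_sum]
  refine Finset.prod_le_prod (fun i _ => ?_) fun i _ => ?_
  · refine mul_nonneg (by norm_num) (Finset.sum_nonneg fun s _ => Finset.sum_nonneg fun b _ => ?_)
    exact mul_nonneg (hw0 _ _) (Real.exp_pos _).le
  · refine le_trans ?_ (Real.add_one_le_exp _)
    calc 1 / 2 * ∑ s, ∑ b, w (i, s) b * v (i, s) b
        ≤ 1 / 2 * ∑ s : Bool,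
          (1 - h ^ 2 / 4 * if f (x (i, s)) ≠ g (x (i, s)) then 1 else 0) := by
          gcongr
          exact hone _
      _ = _ := by
          simp only [Fintype.sum_bool]
          ring

lemma selectedExcess_le {n : ℕ} (x : Fin n × Bool → X) (f g g' : X → Label) (σ : Fin n → Bool)
    (y : Fin n × Bool → Label) :
    selectedExcess x f g' σ y ≤ selectedExcess x f g σ y + doubleDist x g g' := by
  have hcard : (doubleDist x g g' : ℝ) =
      ∑ i : Fin n, ∑ s : Bool, if g (x (i, s)) ≠ g' (x (i, s)) then (1 : ℝ) else 0 := by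
    rw [doubleDist, Finset.card_filter, Fintype.sum_prod_type]
    push_cast
    rfl
  rw [hcard, selectedExcess, selectedExcess, ← Finset.sum_add_distrib]
  refine Finset.sum_le_sum fun i _ => ?_
  have h1 : (if g (x (i, σ i)) ≠ g' (x (i, σ i)) then (1 : ℝ) else 0) ≤
      ∑ s : Bool, if g (x (i, s)) ≠ g' (x (i, s)) then (1 : ℝ) else 0 :=
    Finset.single_le_sum (f := fun s => if g (x (i, s)) ≠ g' (x (i, s)) then (1 : ℝ) else 0)
      (fun s _ => by split_ifs <;> norm_num) (Finset.mem_univ _)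
  refine le_trans ?_ (add_le_add_right h1 _)
  cases g (x (i, σ i)) <;> cases g' (x (i, σ i)) <;> cases f (x (i, σ i)) <;>
    cases y (i, σ i) <;> simp

lemma sum_sum_mul_sum {α β κ : Type*} [Fintype α] [Fintype β] (s : Finset κ) (W : β → ℝ)
    (v : κ → ℝ) (Φ : κ → α → β → ℝ) :
    ∑ a, ∑ b, W b * ∑ k ∈ s, v k * Φ k a b = ∑ k ∈ s, v k * ∑ a, ∑ b, W b * Φ k a b := by
  simp only [Finset.mul_sum]
  rw [Finset.sum_congr rfl fun a _ => Finset.sum_comm, Finset.sum_comm]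
  refine Finset.sum_congr rfl fun k _ => ?_
  refine Finset.sum_congr rfl fun a _ => Finset.sum_congr rfl fun b _ => by ring

/-- In the doubled sample, an empirical risk minimizer over the selected half differs from the
noiseless classifier on average at no more points than a multiple of the fixed point. -/
theorem exists_doubleDist_bound (C₀ : ℝ) (hC₀ : 0 < C₀) :
    ∃ K : ℝ, 0 < K ∧ ∀ (X : Type*) (F : Set (X → Label)) (h : ℝ) (n : ℕ), C₀ ≤ h → h ≤ 1 →
      0 < n → ∀ (x : Fin n × Bool → X) (f : X → Label) (w : Fin n × Bool → Label → ℝ), f ∈ F →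
      (∀ j b, 0 ≤ w j b) → (∀ j, ∑ b, w j b = 1) →
      (∀ j, h ≤ w j (f (x j)) - w j (!f (x j))) →
      ∀ out : (Fin n → Bool) → (Fin n × Bool → Label) → X → Label, (∀ σ y, out σ y ∈ F) →
      (∀ σ y, selectedExcess x f (out σ y) σ y ≤ 0) →
      ∑ σ, ∑ y, doubleWeight w y * doubleDist x (out σ y) f ≤ K * fixedPoint F h 1 n := by
  -- q ≥ 2 keeps the net elements near the shell k at distance at least k / 2; q ≥ 16 / C₀ makes the
  -- approximation loss h k / (2 q) at most half of the gain h² k / 16.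
  obtain ⟨q, hq⟩ := exists_nat_ge (max 2 (16 / C₀))
  have hq2 : (2 : ℝ) ≤ q := (le_max_left _ _).trans hq
  have hq16 : 16 ≤ C₀ * q := by
    have := (le_max_right _ _).trans hq
    rw [div_le_iff₀ hC₀] at this
    linarith
  obtain ⟨J, hJ0, hJ⟩ := exists_hasNet 2 1 q two_pos one_pos
    (by exact_mod_cast (by linarith : (0 : ℝ) < q))
  set b := C₀ ^ 2 / 64 with hb
  have hbpos : 0 < b := by positivity
  have hsummable : Summable fun k : ℕ => (k : ℝ) ^ 1 * Real.exp (-b * k) :=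
    Real.summable_pow_mul_exp_neg_nat_mul 1 hbpos
  set Sb := ∑' k : ℕ, (k : ℝ) ^ 1 * Real.exp (-b * k) with hSb
  have hSb0 : 0 ≤ Sb := tsum_nonneg fun k => by positivity
  refine ⟨J + J / b + Sb, by positivity, ?_⟩
  intro X F h n hh h1 hn x f w hf hw0 hw1 hm out houtF hERM
  have hpos : 0 < h := hC₀.trans_le hh
  set Γ := fixedPoint F h 1 n with hΓ
  have hΓ1 : (1 : ℝ) ≤ Γ := by exact_mod_cast one_le_fixedPoint F hpos h1 1 n
  have e : Fin (2 * n) ≃ Fin n × Bool := Fintype.equivOfCardEq (by simp [mul_comm])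
  have hρ : ∀ g g', rhoH (fun i => x (e i)) g g' = doubleDist x g g' := by
    intro g g'
    rw [rhoH_eq_sum, doubleDist, Finset.card_filter]
    exact e.sum_comp fun j => if g (x j) ≠ g' (x j) then 1 else 0
  have hcomm : ∀ g g', doubleDist x g g' = doubleDist x g' g := fun g g' => by
    rw [← hρ, rhoH_comm, hρ]
  -- Beyond r₀ the nets are available, and b k absorbs their entropy J Γ.
  set r₀ : ℝ := (J + J / b) * Γ with hr₀
  have hr₀0 : 0 ≤ r₀ := by positivity
  have htail : ∀ k : ℕ, r₀ ≤ k → ∑ σ, ∑ y, doubleWeight w y *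
      (if doubleDist x (out σ y) f = k then 1 else 0) ≤ Real.exp (-b * k) := by
    intro k hk
    obtain ⟨L, hL, H⟩ := hJ X F h n (2 * n) hpos h1 (by omega) le_rfl (by omega) k (by
      refine le_trans ?_ hk
      rw [hr₀]
      gcongr
      have : 0 ≤ J / b := by positivity
      linarith)
    obtain ⟨T, hTF, hTc, hT⟩ := H (fun i => x (e i)) f hf
    set T' := T.filter fun g => (k : ℝ) / 2 ≤ doubleDist x f g with hT'
    -- The output has nonpositive excess, so a net element within k / q of it has excess at most k /
    -- q, and its exponential weight is at least 1.
    have hpt : ∀ σ y, (if doubleDist x (out σ y) f = k then (1 : ℝ) else 0) ≤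
        ∑ g ∈ T', Real.exp (h / 2 * (k / q)) *
          Real.exp (-(h / 2) * selectedExcess x f g σ y) := by
      intro σ y
      split_ifs with hdist
      · obtain ⟨g, hg, hgρ⟩ := hT (out σ y) (houtF σ y) (by
          rw [hρ, hcomm, hdist])
        have hgT' : g ∈ T' := by
          rw [hT', Finset.mem_filter]
          refine ⟨hg, ?_⟩
          have h2 := rhoH_triangle (fun i => x (e i)) f g (out σ y)
          rw [hρ f (out σ y), hcomm f (out σ y), hdist, hρ f g] at h2
          have h3 : (k : ℝ) / q ≤ k / 2 := by gcongr
          linarith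
        refine le_trans ?_ (Finset.single_le_sum (f := fun g => Real.exp (h / 2 * (k / q)) *
          Real.exp (-(h / 2) * selectedExcess x f g σ y)) (fun _ _ => by positivity) hgT')
        rw [← Real.exp_add, ← Real.exp_zero]
        apply Real.exp_le_exp.2
        have h4 := selectedExcess_le x f (out σ y) g σ y
        rw [← hρ, rhoH_comm] at h4
        have h5 := hERM σ y
        nlinarith
      · exact Finset.sum_nonneg fun _ _ => by positivity
    calc ∑ σ, ∑ y, doubleWeight w y * (if doubleDist x (out σ y) f = k then 1 else 0)
        ≤ ∑ σ, ∑ y, doubleWeight w y * ∑ g ∈ T', Real.exp (h / 2 * (k / q)) *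
          Real.exp (-(h / 2) * selectedExcess x f g σ y) := by
          gcongr with σ _ y _
          · exact doubleWeight_nonneg hw0 y
          · exact hpt σ y
      _ = ∑ g ∈ T', Real.exp (h / 2 * (k / q)) * ∑ σ, ∑ y, doubleWeight w y *
          Real.exp (-(h / 2) * selectedExcess x f g σ y) :=
          sum_sum_mul_sum T' _ (fun _ => Real.exp (h / 2 * (k / q)))
            fun g σ y => Real.exp (-(h / 2) * selectedExcess x f g σ y)
      _ ≤ ∑ g ∈ T', Real.exp (h / 2 * (k / q)) * Real.exp (-(h ^ 2 / 8 * (k / 2))) := by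
          gcongr with g hg
          refine (sum_doubleWeight_mul_exp_le hpos.le h1 hw0 hw1 x f g hm).trans ?_
          have := (Finset.mem_filter.1 hg).2
          gcongr
      _ = T'.card * Real.exp (h / 2 * (k / q) + -(h ^ 2 / 8 * (k / 2))) := by
          rw [Real.exp_add]
          simp
      _ ≤ Real.exp (J * Γ) * Real.exp (h / 2 * (k / q) + -(h ^ 2 / 8 * (k / 2))) := by
          gcongr
          refine le_trans ?_ hL
          exact_mod_cast (Finset.card_filter_le _ _).trans hTc
      _ ≤ Real.exp (-b * k) := by
          rw [← Real.exp_add]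
          apply Real.exp_le_exp.2
          have h2 : J * Γ ≤ b * k := by
            have : J / b * Γ ≤ k := by
              refine le_trans ?_ hk
              rw [hr₀]
              have : 0 ≤ J * (Γ : ℝ) := by positivity
              linarith
            rw [div_mul_eq_mul_div, div_le_iff₀ hbpos] at this
            linarith
          have h3 : h / 2 * (k / q) ≤ h ^ 2 * k / 32 := by
            have : 16 ≤ h * q := by nlinarith
            rw [mul_div_assoc', div_le_div_iff₀ (by linarith) (by norm_num)]
            have hk0 : 0 ≤ h * k := by positivity
            nlinarith
          have h4 : 2 * b * k ≤ h ^ 2 * k / 32 := by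
            rw [hb]
            have : C₀ ^ 2 ≤ h ^ 2 := by gcongr
            have hk0 : (0 : ℝ) ≤ k := by positivity
            nlinarith
          nlinarith
  -- Distances up to r₀ are kept as they are; the larger ones are summed over their exact values,
  -- with a convergent series of tails.
  have hpt : ∀ σ y, (doubleDist x (out σ y) f : ℝ) ≤ r₀ + ∑ k ∈ Finset.range (2 * n + 1),
      (if r₀ ≤ k then (k : ℝ) else 0) * (if doubleDist x (out σ y) f = k then 1 else 0) := by
    intro σ y
    rcases le_total (doubleDist x (out σ y) f : ℝ) r₀ with hle | hle
    · have : 0 ≤ ∑ k ∈ Finset.range (2 * n + 1),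
          (if r₀ ≤ k then (k : ℝ) else 0) * (if doubleDist x (out σ y) f = k then 1 else 0) :=
        Finset.sum_nonneg fun k _ => by split_ifs <;> simp
      linarith
    · have h2 : doubleDist x (out σ y) f ∈ Finset.range (2 * n + 1) := by
        rw [Finset.mem_range, ← hρ]
        exact Nat.lt_succ_of_le (rhoH_le _ _ _)
      have h3 := Finset.single_le_sum (f := fun k : ℕ => (if r₀ ≤ k then (k : ℝ) else 0) *
          (if doubleDist x (out σ y) f = k then 1 else 0))
        (fun k _ => by split_ifs <;> simp) h2
      simp only [if_pos hle, if_true, mul_one] at h3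
      linarith
  calc ∑ σ, ∑ y, doubleWeight w y * doubleDist x (out σ y) f
      ≤ ∑ σ, ∑ y, doubleWeight w y * (r₀ + ∑ k ∈ Finset.range (2 * n + 1),
        (if r₀ ≤ k then (k : ℝ) else 0) * (if doubleDist x (out σ y) f = k then 1 else 0)) := by
        gcongr with σ _ y _
        · exact doubleWeight_nonneg hw0 y
        · exact hpt σ y
    _ = r₀ + ∑ k ∈ Finset.range (2 * n + 1), (if r₀ ≤ k then (k : ℝ) else 0) * ∑ σ, ∑ y,
        doubleWeight w y * (if doubleDist x (out σ y) f = k then 1 else 0) := by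
        rw [← sum_sum_mul_sum _ (doubleWeight w) (fun k : ℕ => if r₀ ≤ k then (k : ℝ) else 0)
          fun k σ y => if doubleDist x (out σ y) f = k then 1 else 0]
        simp only [mul_add, Finset.sum_add_distrib]
        simp only [← Finset.sum_mul]
        rw [sum_doubleWeight hw1, one_mul]
    _ ≤ r₀ + ∑ k ∈ Finset.range (2 * n + 1), (k : ℝ) ^ 1 * Real.exp (-b * k) := by
        refine add_le_add le_rfl (Finset.sum_le_sum fun k _ => ?_)
        split_ifs with hk
        · rw [pow_one]
          exact mul_le_mul_of_nonneg_left (htail k hk) (by positivity)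
        · rw [zero_mul]
          positivity
    _ ≤ r₀ + Sb := by
        gcongr
        exact hsummable.sum_le_tsum _ fun k _ => by positivity
    _ ≤ _ := by
        rw [hr₀]
        nlinarith

end Symmetrization

/-! ### From the doubled sample to the risk of an ERM -/

section UpperBound

open ProbabilityTheory

variable {X : Type*} [MeasurableSpace X]

/-- Integration over a product of composition-products, labels first. -/
lemma pi_compProd_eq {ι : Type*} [Fintype ι] [DecidableEq ι] (μ : Measure X)
    [IsProbabilityMeasure μ] (κ : Kernel X Label) [IsMarkovKernel κ] :
    (Measure.pi fun _ : ι => μ ⊗ₘ κ) = ∑ y : ι → Label,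
      ((Measure.pi fun _ : ι => μ).withDensity fun x => ∏ j, κ (x j) {y j}).map
        fun x j => (x j, y j) := by
  have hκ : ∀ b : Label, Measurable fun a => κ a {b} := fun b =>
    κ.measurable_coe (measurableSet_singleton b)
  have hzip : ∀ y : ι → Label, Measurable fun (x : ι → X) j => (x j, y j) := fun y => by fun_prop
  refine Measure.pi_eq fun s hs => ?_
  have hmeas : ∀ j b, Measurable fun a => κ a {b} * (s j).indicator 1 (a, b) := fun j b =>
    (hκ b).mul ((measurable_one.indicator (hs j)).comp measurable_prodMk_right)
  have h1 : ∀ j, (μ ⊗ₘ κ) (s j) = ∑ b, ∫⁻ a, κ a {b} * (s j).indicator 1 (a, b) ∂μ := by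
    intro j
    rw [Measure.compProd_apply (hs j), ← lintegral_finsetSum _ fun b _ => hmeas j b]
    refine lintegral_congr fun a => ?_
    rw [← lintegral_indicator_one (measurable_prodMk_left (hs j)), lintegral_fintype]
    refine Finset.sum_congr rfl fun b _ => ?_
    rw [mul_comm]
    rfl
  simp only [h1]
  have h2 := Finset.prod_univ_sum (fun _ : ι => (Finset.univ : Finset Label))
    (fun j b => ∫⁻ a, κ a {b} * (s j).indicator 1 (a, b) ∂μ)
  rw [Fintype.piFinset_univ] at h2
  rw [h2, Measure.finsetSum_apply]
  refine Finset.sum_congr rfl fun y _ => ?_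
  have hbox : MeasurableSet (Set.univ.pi s) := MeasurableSet.univ_pi hs
  rw [Measure.map_apply (hzip y) hbox, withDensity_apply _ (hzip y hbox),
    ← lintegral_indicator (hzip y hbox)]
  have h3 : ∀ x : ι → X, ((fun (x : ι → X) j => (x j, y j)) ⁻¹' Set.univ.pi s).indicator
      (fun x => ∏ j, κ (x j) {y j}) x =
      ∏ j, (κ (x j) {y j} * (s j).indicator 1 (x j, y j)) := by
    intro x
    by_cases hx : ∀ j, (x j, y j) ∈ s j
    · rw [Set.indicator_of_mem (by simpa using hx)]
      exact Finset.prod_congr rfl fun j _ => by simp [hx j]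
    · rw [Set.indicator_of_notMem (by simpa using hx)]
      push Not at hx
      obtain ⟨j, hj⟩ := hx
      rw [Finset.prod_eq_zero (Finset.mem_univ j)]
      simp [hj]
  simp only [h3]
  have hind : iIndepFun (fun j (x : ι → X) => κ (x j) {y j} * (s j).indicator 1 (x j, y j))
      (Measure.pi fun _ : ι => μ) :=
    iIndepFun_pi (X := fun j a => κ a {y j} * (s j).indicator 1 (a, y j))
      fun j => (hmeas j (y j)).aemeasurable
  rw [lintegral_prod_eq_prod_lintegral_of_indepFun Finset.univ _ hind
    fun j => (hmeas j (y j)).comp (measurable_pi_apply j)]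
  refine Finset.prod_congr rfl fun j _ => ?_
  exact (measurePreserving_eval (fun _ : ι => μ) j).lintegral_comp (hmeas j (y j))

lemma lintegral_pi_compProd {ι : Type*} [Fintype ι] [DecidableEq ι] (μ : Measure X)
    [IsProbabilityMeasure μ] (κ : Kernel X Label) [IsMarkovKernel κ]
    {φ : (ι → X × Label) → ENNReal} (hφ : Measurable φ) :
    ∫⁻ z, φ z ∂(Measure.pi fun _ : ι => μ ⊗ₘ κ) =
      ∫⁻ x, ∑ y : ι → Label, (∏ j, κ (x j) {y j}) * φ (fun j => (x j, y j))
        ∂(Measure.pi fun _ : ι => μ) := by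
  have hκ : ∀ y : ι → Label, Measurable fun x : ι → X => ∏ j, κ (x j) {y j} := fun y =>
    Finset.measurable_prod _ fun j _ =>
      (κ.measurable_coe (measurableSet_singleton (y j))).comp (measurable_pi_apply j)
  have hzip : ∀ y : ι → Label, Measurable fun (x : ι → X) j => (x j, y j) := fun y => by fun_prop
  have hm : ∀ y : ι → Label, Measurable fun x : ι → X =>
      (∏ j, κ (x j) {y j}) * φ (fun j => (x j, y j)) := fun y => (hκ y).mul (hφ.comp (hzip y))
  rw [pi_compProd_eq, lintegral_finsetSum_measure, lintegral_finsetSum _ fun y _ => hm y]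
  refine Finset.sum_congr rfl fun y _ => ?_
  rw [lintegral_map hφ (hzip y)]
  exact lintegral_withDensity_eq_lintegral_mul _ (hκ y) (hφ.comp (hzip y))

/-- The doubled sample with selected half `S` and unselected half `S'`. -/
def merge {n : ℕ} {Z : Type*} (σ : Fin n → Bool) (p : (Fin n → Z) × (Fin n → Z))
    (j : Fin n × Bool) : Z := if j.2 = σ j.1 then p.1 j.1 else p.2 j.1

/-- A fixed selection only permutes the two coordinates of each pair, which an i.i.d. law does not
notice. -/
lemma measurePreserving_merge {n : ℕ} {Z : Type*} [MeasurableSpace Z] (P : Measure Z)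
    [IsProbabilityMeasure P] (σ : Fin n → Bool) :
    MeasurePreserving (merge σ) ((Measure.pi fun _ : Fin n => P).prod (Measure.pi fun _ => P))
      (Measure.pi fun _ : Fin n × Bool => P) := by
  have hm : Measurable (merge (Z := Z) σ) := by
    refine measurable_pi_lambda _ fun j => ?_
    unfold merge
    split_ifs <;> fun_prop
  refine ⟨hm, (Measure.pi_eq fun s hs => ?_).symm⟩
  rw [Measure.map_apply hm (MeasurableSet.univ_pi hs)]
  have h1 : merge (Z := Z) σ ⁻¹' Set.univ.pi s =
      (Set.univ.pi fun i => s (i, σ i)) ×ˢ (Set.univ.pi fun i => s (i, !σ i)) := by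
    ext p
    simp only [Set.mem_preimage, Set.mem_pi, Set.mem_univ, true_imp_iff, Set.mem_prod, Prod.forall]
    constructor
    · intro h
      refine ⟨fun i => ?_, fun i => ?_⟩
      · simpa [merge] using h i (σ i)
      · simpa [merge] using h i (!σ i)
    · rintro ⟨h, h'⟩ i b
      by_cases hb : b = σ i
      · subst hb
        simpa [merge] using h i
      · have hb' : b = !σ i := by
          revert hb
          cases b <;> cases σ i <;> simp
        subst hb'
        simpa [merge] using h' i
  rw [h1, Measure.prod_prod, Measure.pi_pi, Measure.pi_pi, ← Finset.prod_mul_distrib,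
    Fintype.prod_prod_type]
  refine Finset.prod_congr rfl fun i _ => ?_
  cases σ i <;> simp [mul_comm]

/-- Under the margin condition the noiseless label is the likelier one by `h`. -/
lemma margin_le_of_bayes {P : ProbabilityMeasure (X × Label)} {h : ℝ} {a : X} {f : X → Label}
    (hf : f a = bayes P a) (hh : h ≤ |eta P a|) :
    h ≤ ((P : Measure (X × Label)).condKernel a).real {f a} -
      ((P : Measure (X × Label)).condKernel a).real {!f a} := by
  have heta : eta P a = ((P : Measure (X × Label)).condKernel a).real {true} -
      ((P : Measure (X × Label)).condKernel a).real {false} := by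
    rw [eta, integral_fintype .of_finite]
    simp [Label.val]
    ring
  by_cases h0 : 0 ≤ eta P a
  · have : f a = true := by rw [hf, bayes]; simp [h0]
    rw [abs_of_nonneg h0] at hh
    rw [this]
    simpa [← heta] using hh
  · have : f a = false := by rw [hf, bayes]; simp [h0]
    rw [abs_of_neg (not_le.1 h0)] at hh
    rw [this]
    simp only [Bool.not_false]
    linarith

/-- The number of errors of the output on `S` relative to `f` on a second sample. -/
def ghostCount {n : ℕ} (A : Learner X n) (f : X → Label) (S S' : Fin n → X × Label) : ℕ :=
  (Finset.univ.filter fun i => A.out S (S' i).1 ≠ f (S' i).1).card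

lemma measurable_ghostCount {n : ℕ} (A : Learner X n) {f : X → Label} (hf : Measurable f)
    {Ω : Type*} [MeasurableSpace Ω] {S S' : Ω → Fin n → X × Label} (hS : Measurable S)
    (hS' : Measurable S') : Measurable fun ω => (ghostCount A f (S ω) (S' ω) : ENNReal) := by
  simp only [ghostCount, Finset.card_filter]
  push_cast
  refine Finset.measurable_sum _ fun i _ => ?_
  have hi : Measurable fun ω => (S' ω i).1 := ((measurable_pi_apply i).comp hS').fst
  have h1 : Measurable fun ω => A.out (S ω) (S' ω i).1 := A.measurable_out.comp (hS.prodMk hi)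
  exact Measurable.ite (measurableSet_eq_fun h1 (hf.comp hi)).compl measurable_const
    measurable_const

lemma lintegral_ghostCount {n : ℕ} (P : Measure (X × Label)) [IsProbabilityMeasure P]
    (A : Learner X n) {f : X → Label} (hf : Measurable f) (S : Fin n → X × Label) :
    ∫⁻ S', (ghostCount A f S S' : ENNReal) ∂(Measure.pi fun _ : Fin n => P) =
      n * P {z | A.out S z.1 ≠ f z.1} := by
  have hs : MeasurableSet {z : X × Label | A.out S z.1 ≠ f z.1} :=
    (measurableSet_eq_fun ((measurable_learner_out A S).comp measurable_fst)
      (hf.comp measurable_fst)).compl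
  have h1 : ∀ S', (ghostCount A f S S' : ENNReal) =
      ∑ i, {z : X × Label | A.out S z.1 ≠ f z.1}.indicator 1 (S' i) := by
    intro S'
    rw [ghostCount, Finset.card_filter]
    push_cast
    exact Finset.sum_congr rfl fun i _ => by simp [Set.indicator]
  have hm : ∀ i : Fin n, Measurable fun S' : Fin n → X × Label =>
      {z : X × Label | A.out S z.1 ≠ f z.1}.indicator (1 : X × Label → ENNReal) (S' i) :=
    fun i => (measurable_one.indicator hs).comp (measurable_pi_apply i)
  simp only [h1]
  rw [lintegral_finsetSum _ fun i _ => hm i]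
  have h2 : ∀ i, ∫⁻ S', {z : X × Label | A.out S z.1 ≠ f z.1}.indicator 1 (S' i)
      ∂(Measure.pi fun _ : Fin n => P) = P {z | A.out S z.1 ≠ f z.1} := by
    intro i
    rw [(measurePreserving_eval (fun _ : Fin n => P) i).lintegral_comp
      (measurable_one.indicator hs), lintegral_indicator_one hs]
  simp [h2]

/-- The output depends on the selected half only, so the unselected half is a fresh sample that
measures its disagreement with `f`. -/
lemma lintegral_disagreement_eq {n : ℕ} (P : Measure (X × Label)) [IsProbabilityMeasure P]
    (A : Learner X n) {f : X → Label} (hf : Measurable f) (σ : Fin n → Bool) :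
    ∫⁻ ω : Fin n × Bool → X × Label,
      (ghostCount A f (fun i => ω (i, σ i)) (fun i => ω (i, !σ i)) : ENNReal)
      ∂(Measure.pi fun _ : Fin n × Bool => P) =
      n * ∫⁻ S, P {z | A.out S z.1 ≠ f z.1} ∂(Measure.pi fun _ : Fin n => P) := by
  have hm : Measurable fun p : (Fin n → X × Label) × (Fin n → X × Label) =>
      (ghostCount A f p.1 p.2 : ENNReal) :=
    measurable_ghostCount A hf measurable_fst measurable_snd
  have hms : Measurable fun ω : Fin n × Bool → X × Label =>
      (ghostCount A f (fun i => ω (i, σ i)) (fun i => ω (i, !σ i)) : ENNReal) :=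
    measurable_ghostCount A hf (by fun_prop) (by fun_prop)
  rw [← (measurePreserving_merge P σ).lintegral_comp hms]
  have h1 : ∀ p : (Fin n → X × Label) × (Fin n → X × Label),
      (fun i => merge σ p (i, σ i)) = p.1 ∧ (fun i => merge σ p (i, !σ i)) = p.2 := by
    intro p
    constructor <;> funext i <;> simp [merge]
  simp only [(h1 _).1, (h1 _).2]
  rw [lintegral_prod _ hm.aemeasurable]
  simp only [lintegral_ghostCount P A hf]
  rw [lintegral_const_mul' _ _ (ENNReal.natCast_ne_top n)]

lemma selectedExcess_nonpos_of_isERM {n : ℕ} (hn : 0 < n) {F : Set (X → Label)} {A : Learner X n}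
    (hA : IsERM F A) {f : X → Label} (hf : f ∈ F) (x : Fin n × Bool → X) (σ : Fin n → Bool)
    (y : Fin n × Bool → Label) :
    selectedExcess x f (A.out fun i => (x (i, σ i), y (i, σ i))) σ y ≤ 0 := by
  have hn' : (0 : ℝ) < n := by exact_mod_cast hn
  have h1 := (hA fun i => (x (i, σ i), y (i, σ i))).2 f hf
  rw [empRisk, empRisk, div_le_div_iff_of_pos_right hn', Finset.card_filter,
    Finset.card_filter] at h1
  push_cast at h1
  rw [selectedExcess, Finset.sum_sub_distrib]
  linarith

/-- An error of `g` is an error of `f` or a point where the two disagree. -/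
lemma excess_le_disagreement {P : ProbabilityMeasure (X × Label)} {f g : X → Label}
    (hf : ∀ᵐ a ∂(P : Measure (X × Label)).fst, f a = bayes P a) :
    risk P g - risk P (bayes P) ≤ ((P : Measure (X × Label)) {z | g z.1 ≠ f z.1}).toReal := by
  rw [← risk_congr_ae hf, sub_le_iff_le_add']
  refine (measureReal_mono ?_).trans (measureReal_union_le _ _)
  intro z hz
  by_cases hfz : f z.1 = z.2
  · right
    simp only [ne_eq, Set.mem_ofPred_eq] at hz ⊢
    rwa [hfz]
  · exact Or.inl hfz

/-- The doubled sample reduces the expected disagreement to a bound for each fixed design. -/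
lemma lintegral_disagreement_le {n : ℕ} (Q : Measure (X × Label)) [IsProbabilityMeasure Q]
    (A : Learner X n) {f : X → Label} (hf : Measurable f) {B : ℝ}
    (hB : ∀ᵐ x ∂(Measure.pi fun _ : Fin n × Bool => Q.fst),
      ∑ σ : Fin n → Bool, ∑ y : Fin n × Bool → Label,
        doubleWeight (fun j b => (Q.condKernel (x j)).real {b}) y *
        doubleDist x (A.out fun i => (x (i, σ i), y (i, σ i))) f ≤ B) :
    n * ∫⁻ S, Q {z | A.out S z.1 ≠ f z.1} ∂(Measure.pi fun _ : Fin n => Q) ≤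
      ENNReal.ofReal B := by
  set κ := Q.condKernel with hκ
  set D : ENNReal := ∫⁻ S, Q {z | A.out S z.1 ≠ f z.1} ∂(Measure.pi fun _ : Fin n => Q) with hD
  have hdis : Q.fst ⊗ₘ κ = Q := Measure.disintegrate Q κ
  set φ : (Fin n → Bool) → (Fin n × Bool → X × Label) → ENNReal := fun σ ω =>
    (ghostCount A f (fun i => ω (i, σ i)) (fun i => ω (i, !σ i)) : ENNReal) with hφ
  have hφm : ∀ σ, Measurable (φ σ) := fun σ =>
    measurable_ghostCount A hf (by fun_prop) (by fun_prop)
  have hφD : ∀ σ, ∫⁻ ω, φ σ ω ∂(Measure.pi fun _ : Fin n × Bool => Q) = n * D := fun σ =>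
    lintegral_disagreement_eq Q A hf σ
  have hhalf : ENNReal.ofReal ((1 / 2) ^ n) * 2 ^ n = 1 := by
    rw [show (2 : ENNReal) = ENNReal.ofReal 2 by simp, ← ENNReal.ofReal_pow (by norm_num),
      ← ENNReal.ofReal_mul (by positivity), ← mul_pow]
    simp
  -- All 2 ^ n selections give the same integral, so averaging over them is free.
  have h2 : n * D = ∫⁻ ω, ENNReal.ofReal ((1 / 2) ^ n) * ∑ σ, φ σ ω
      ∂(Measure.pi fun _ : Fin n × Bool => Q) := by
    rw [lintegral_const_mul' _ _ ENNReal.ofReal_ne_top, lintegral_finsetSum _ fun σ _ => hφm σ,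
      Finset.sum_congr rfl fun σ _ => hφD σ]
    simp only [Finset.sum_const, Finset.card_univ, Fintype.card_pi, Fintype.card_bool,
      Finset.prod_const, Fintype.card_fin, nsmul_eq_mul]
    push_cast
    rw [← mul_assoc, hhalf, one_mul]
  have hφm' : Measurable fun ω => ENNReal.ofReal ((1 / 2) ^ n) * ∑ σ, φ σ ω :=
    (Finset.measurable_sum _ fun σ _ => hφm σ).const_mul _
  have h3 := lintegral_pi_compProd Q.fst κ hφm'
  rw [hdis] at h3
  rw [h2, h3]
  calc ∫⁻ x, ∑ y : Fin n × Bool → Label, (∏ j, κ (x j) {y j}) *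
        (ENNReal.ofReal ((1 / 2) ^ n) * ∑ σ, φ σ fun j => (x j, y j))
        ∂(Measure.pi fun _ : Fin n × Bool => Q.fst)
      ≤ ∫⁻ _x, ENNReal.ofReal B ∂(Measure.pi fun _ : Fin n × Bool => Q.fst) := by
        refine lintegral_mono_ae ?_
        filter_upwards [hB] with x hb
        set w : Fin n × Bool → Label → ℝ := fun j b => (κ (x j)).real {b} with hw
        have hw0 : ∀ j b, 0 ≤ w j b := fun j b => measureReal_nonneg
        refine le_trans ?_ (ENNReal.ofReal_le_ofReal hb)
        rw [Finset.sum_comm, ENNReal.ofReal_sum_of_nonneg fun y _ => Finset.sum_nonneg fun σ _ =>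
          mul_nonneg (doubleWeight_nonneg hw0 y) (by positivity)]
        refine Finset.sum_le_sum fun y _ => ?_
        rw [← Finset.mul_sum, ENNReal.ofReal_mul (doubleWeight_nonneg hw0 y), doubleWeight,
          ENNReal.ofReal_mul (by positivity),
          ENNReal.ofReal_prod_of_nonneg fun j _ => hw0 j _, ← mul_assoc,
          mul_comm (∏ j, κ (x j) {y j})]
        have h4 : ∀ j, ENNReal.ofReal (w j (y j)) = κ (x j) {y j} := fun j =>
          ofReal_measureReal
        simp only [h4]
        refine mul_le_mul_right ?_ _
        rw [ENNReal.ofReal_sum_of_nonneg fun σ _ => by positivity]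
        refine Finset.sum_le_sum fun σ _ => ?_
        rw [ENNReal.ofReal_natCast]
        -- The ghost count sees only the unselected half of the doubled design.
        have h5 : ghostCount A f (fun i => (x (i, σ i), y (i, σ i)))
            (fun i => (x (i, !σ i), y (i, !σ i))) ≤
            doubleDist x (A.out fun i => (x (i, σ i), y (i, σ i))) f := by
          unfold ghostCount doubleDist
          refine Finset.card_le_card_of_injOn (fun i => (i, !σ i)) ?_ ?_
          · intro i hi
            simpa using hi
          · intro i _ j _ hij
            exact (Prod.mk.inj hij).1
        exact Nat.cast_le.2 h5
    _ = ENNReal.ofReal B := by simp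

/-- The expected excess risk is at most the expected disagreement with the Bayes classifier. -/
lemma expectedExcess_le {n : ℕ} {P : ProbabilityMeasure (X × Label)} (A : Learner X n)
    {f : X → Label} (hf : Measurable f)
    (hfb : ∀ᵐ a ∂(P : Measure (X × Label)).fst, f a = bayes P a) :
    expectedExcess P A ≤ (∫⁻ S, (P : Measure (X × Label)) {z | A.out S z.1 ≠ f z.1}
      ∂(Measure.pi fun _ : Fin n => (P : Measure (X × Label)))).toReal := by
  have hDm : Measurable fun S => (P : Measure (X × Label)) {z | A.out S z.1 ≠ f z.1} := by
    have hE : MeasurableSet {p : (Fin n → X × Label) × (X × Label) |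
        A.out p.1 p.2.1 ≠ f p.2.1} := by
      have hm : Measurable fun p : (Fin n → X × Label) × (X × Label) => (p.1, p.2.1) := by fun_prop
      exact (measurableSet_eq_fun (A.measurable_out.comp hm)
        (hf.comp (measurable_fst.comp measurable_snd))).compl
    exact measurable_measure_prodMk_left hE
  rw [expectedExcess, ← integral_toReal hDm.aemeasurable
    (Filter.Eventually.of_forall fun S => measure_lt_top _ _)]
  by_cases hi : Integrable (fun S => risk P (A.out S) - risk P (bayes P))
      (Measure.pi fun _ : Fin n => (P : Measure (X × Label)))
  · refine integral_mono hi ?_ fun S => excess_le_disagreement hfb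
    refine Integrable.of_bound hDm.ennreal_toReal.aestronglyMeasurable 1
      (Filter.Eventually.of_forall fun S => ?_)
    rw [Real.norm_of_nonneg ENNReal.toReal_nonneg]
    exact measureReal_le_one
  -- Without integrability the expected excess is 0 by convention.
  · rw [integral_undef hi]
    exact integral_nonneg fun S => ENNReal.toReal_nonneg

/-- The upper bound for empirical risk minimizers. -/
theorem exists_upper_bound (C₀ : ℝ) (hC₀ : 0 < C₀) :
    ∃ K : ℝ, 0 < K ∧ ∀ (X : Type*) [MeasurableSpace X] (F : Set (X → Label)) (n : ℕ) (h : ℝ),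
      (∀ f ∈ F, Measurable f) → 0 < n → C₀ ≤ h → h ≤ 1 → ∀ A : Learner X n, IsERM F A →
      ∀ P ∈ massart h F, expectedExcess P A ≤ K * fixedPoint F h 1 n / n := by
  obtain ⟨K, hK, hbound⟩ := exists_doubleDist_bound C₀ hC₀
  refine ⟨K, hK, ?_⟩
  intro X _ F n h hmeas hn hh h1 A hA P hP
  obtain ⟨⟨f, hfF, hfb⟩, hmargin⟩ := hP
  have hn' : (0 : ℝ) < n := by exact_mod_cast hn
  have hmain := lintegral_disagreement_le (P : Measure (X × Label)) A (hmeas f hfF)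
    (B := K * fixedPoint F h 1 n) (by
      have hae : ∀ᵐ x ∂(Measure.pi fun _ : Fin n × Bool => (P : Measure (X × Label)).fst), ∀ j,
          f (x j) = bayes P (x j) ∧ h ≤ |eta P (x j)| :=
        Filter.eventually_all.2 fun j =>
          (measurePreserving_eval (fun _ : Fin n × Bool => (P : Measure (X × Label)).fst)
            j).quasiMeasurePreserving.ae (hfb.and hmargin)
      filter_upwards [hae] with x hx
      exact hbound X F h n hh h1 hn x f _ hfF (fun j b => measureReal_nonneg)
        (fun j => by rw [sum_measureReal_singleton, Finset.coe_univ, probReal_univ])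
        (fun j => margin_le_of_bayes (hx j).1 (hx j).2)
        (fun σ y => A.out fun i => (x (i, σ i), y (i, σ i)))
        (fun σ y => (hA _).1)
        (fun σ y => selectedExcess_nonpos_of_isERM hn hA hfF x σ y))
  refine (expectedExcess_le A (hmeas f hfF) hfb).trans ?_
  rw [le_div_iff₀ hn']
  have h5 := ENNReal.toReal_mono ENNReal.ofReal_ne_top hmain
  rw [ENNReal.toReal_ofReal (by positivity), ENNReal.toReal_mul, ENNReal.toReal_natCast] at h5
  linarith

end UpperBound

/-! ### Comparison of the rates and choice of constants -/

/-- If the worst-case excess of one learner is at most a multiple of a quantity that bounds the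
worst-case excess of every learner from below, that learner is minimax up to a constant. -/
lemma worstExcess_le_mul_minimaxExcess {X : Type*} [MeasurableSpace X] {F : Set (X → Label)}
    {n : ℕ} {h K K' l : ℝ} (hK : 0 ≤ K) (hK' : 0 < K') (A : Learner X n)
    (hA : ∀ P ∈ massart h F, expectedExcess P A ≤ K * l)
    (hl : ∀ A' : Learner X n, ∃ P ∈ massart h F, K'⁻¹ * l ≤ expectedExcess P A') :
    worstExcess h F A ≤ ENNReal.ofReal (K * K') * minimaxExcess h F n := by
  rcases eq_or_lt_of_le (mul_nonneg hK hK'.le) with h0 | h0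
  · rw [← h0]
    refine iSup₂_le fun P hP => ?_
    have hK0 : K = 0 := by
      rcases mul_eq_zero.1 h0.symm with h | h
      · exact h
      · exact absurd h hK'.ne'
    have := hA P hP
    rw [hK0, zero_mul] at this
    simp [ENNReal.ofReal_of_nonpos this]
  have h1 : (ENNReal.ofReal (K * K'))⁻¹ * worstExcess h F A ≤ minimaxExcess h F n := by
    refine le_iInf fun A' => ?_
    obtain ⟨P', hP', hle⟩ := hl A'
    refine le_trans ?_ (le_iSup₂_of_le P' hP' (ENNReal.ofReal_le_ofReal hle))
    rw [← ENNReal.ofReal_inv_of_pos h0, worstExcess, ENNReal.mul_iSup]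
    refine iSup_le fun P => ?_
    rw [ENNReal.mul_iSup]
    refine iSup_le fun hP => ?_
    rw [← ENNReal.ofReal_mul (by positivity)]
    refine ENNReal.ofReal_le_ofReal ?_
    have hKpos : 0 < K := pos_of_mul_pos_left h0 hK'.le
    calc (K * K')⁻¹ * expectedExcess P A ≤ (K * K')⁻¹ * (K * l) := by
          gcongr
          exact hA P hP
      _ = K'⁻¹ * l := by field_simp
  rw [mul_comm, ← div_eq_mul_inv] at h1
  rw [mul_comm]
  exact (ENNReal.div_le_iff (by simpa using h0) ENNReal.ofReal_ne_top).1 h1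

/-- The sample size in the lower rate is comparable with `n`. -/
lemma ceil_bounds {C₀ C₁ c h : ℝ} {m₁ m₂ n : ℕ} (hC₀ : 0 < C₀) (hC₁ : C₁ < 1) (hc : 1 ≤ c)
    (hm₁ : 1 / C₀ ≤ m₁) (hm₂ : c / (1 - C₁) + 1 ≤ m₂) (hn : 0 < n) (hh : C₀ ≤ h) (hh₁ : h ≤ C₁) :
    0 < ⌈n * c * h / (1 - h)⌉₊ ∧ n ≤ m₁ * ⌈n * c * h / (1 - h)⌉₊ ∧
      ⌈n * c * h / (1 - h)⌉₊ ≤ m₂ * n := by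
  have hn1 : (1 : ℝ) ≤ n := by exact_mod_cast hn
  have hpos : 0 < h := hC₀.trans_le hh
  have hc0 : 0 < c := by linarith
  have hh' : 0 < 1 - h := by linarith
  have hC₁' : 0 < 1 - C₁ := by linarith
  have hNlow : n * c * h / (1 - h) ≤ ⌈n * c * h / (1 - h)⌉₊ := Nat.le_ceil _
  have hNup : (⌈n * c * h / (1 - h)⌉₊ : ℝ) < n * c * h / (1 - h) + 1 :=
    Nat.ceil_lt_add_one (by positivity)
  refine ⟨by rw [Nat.ceil_pos]; positivity, ?_, ?_⟩
  · have h1 : n * C₀ ≤ ⌈n * c * h / (1 - h)⌉₊ := by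
      refine le_trans ?_ hNlow
      rw [le_div_iff₀ hh']
      have h2 : n * C₀ * (1 - h) ≤ n * C₀ := mul_le_of_le_one_right (by positivity) (by linarith)
      have h3 : n * C₀ ≤ n * c * h := by
        rw [mul_assoc]
        gcongr
        nlinarith
      linarith
    have h2 : 1 ≤ m₁ * C₀ := by rwa [div_le_iff₀ hC₀] at hm₁
    have : (n : ℝ) ≤ m₁ * ⌈n * c * h / (1 - h)⌉₊ :=
      calc (n : ℝ) ≤ m₁ * C₀ * n := le_mul_of_one_le_left (by positivity) h2
        _ = m₁ * (n * C₀) := by ring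
        _ ≤ _ := by gcongr
    exact_mod_cast this
  · have h1 : n * c * h / (1 - h) ≤ n * (c / (1 - C₁)) := by
      rw [mul_div_assoc', div_le_div_iff₀ hh' hC₁', mul_assoc _ h]
      have : h * (1 - C₁) ≤ 1 - h := by nlinarith
      gcongr
    have h2 := mul_le_mul_of_nonneg_right hm₂ (zero_le_one.trans hn1)
    have : (⌈n * c * h / (1 - h)⌉₊ : ℝ) ≤ m₂ * n := by linarith
    exact_mod_cast this

/-- Both terms are charged to Γ: the first through d ≤ kd Γ and h ≥ C₀, the second through 1 - h ≤ 1
and 1 / c ≤ 1. -/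
lemma lowerRate_le {X : Type*} {F : Set (X → Label)} {C₀ c h kb kd Γ : ℝ} {d n : ℕ} (hC₀ : 0 < C₀)
    (hc : 1 ≤ c) (hh : C₀ ≤ h) (h1 : h ≤ 1) (hn : (0 : ℝ) < n) (hd : (d : ℝ) ≤ kd * Γ)
    (hG : (fixedPoint F h 1 ⌈n * c * h / (1 - h)⌉₊ : ℝ) ≤ kb * Γ) :
    lowerRate F c h d n ≤ (kd / C₀ + kb) * (Γ / n) := by
  have hpos : 0 < h := hC₀.trans_le hh
  have hh' : 0 ≤ 1 - h := by linarith
  unfold lowerRate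
  set G : ℝ := (fixedPoint F h 1 ⌈n * c * h / (1 - h)⌉₊ : ℝ) with hGdef
  have hG0 : 0 ≤ G := by positivity
  rw [add_mul]
  refine add_le_add ?_ ?_
  · rw [div_mul_div_comm, mul_comm (n : ℝ) h]
    exact div_le_div₀ (le_trans (by positivity) hd) hd (by positivity) (by gcongr)
  · have h3 : 1 / c ≤ 1 := by rw [div_le_one (by linarith)]; exact hc
    have h4 : (1 - h) * G / n ≤ kb * (Γ / n) := by
      rw [mul_div_assoc', div_le_div_iff_of_pos_right hn]
      exact (mul_le_of_le_one_left hG0 (by linarith)).trans hG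
    exact (mul_le_of_le_one_left (by positivity) h3).trans h4

/-- The second term of the lower rate suffices; its prefactor (1 - h) / c is at least (1 - C₁) / c.
-/
lemma upperRate_le {X : Type*} {F : Set (X → Label)} {C₁ c h ka : ℝ} {d n : ℕ} (hC₁ : C₁ < 1)
    (hc : 0 < c) (hpos : 0 < h) (hh : h ≤ C₁) (hka : 0 < ka) (hn : (0 : ℝ) < n)
    (hG : (fixedPoint F h h n : ℝ) ≤ ka * fixedPoint F h 1 ⌈n * c * h / (1 - h)⌉₊) :
    upperRate F h n ≤ ka * (c / (1 - C₁)) * lowerRate F c h d n := by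
  have hC₁' : 0 < 1 - C₁ := by linarith
  unfold lowerRate upperRate
  set G : ℝ := (fixedPoint F h 1 ⌈n * c * h / (1 - h)⌉₊ : ℝ) with hGdef
  have hG0 : 0 ≤ G := by positivity
  have h2 : (1 - C₁) / c * (G / n) ≤ 1 / c * ((1 - h) * G / n) := by
    rw [div_mul_div_comm, div_mul_div_comm, one_mul]
    gcongr
  have h3 : (0 : ℝ) ≤ d / (n * h) := by positivity
  calc (fixedPoint F h h n : ℝ) / n ≤ ka * G / n := by gcongr
    _ = ka * (c / (1 - C₁)) * ((1 - C₁) / c * (G / n)) := by field_simp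
    _ ≤ _ := by
      gcongr
      linarith

end LocalEntropy

end

theorem corollary6p2 (C₀ C₁ c : ℝ) (hC₀ : 0 < C₀) (hC₀₁ : C₀ ≤ C₁) (hC₁ : C₁ < 1) (hc : 1 ≤ c) :
    ∃ K : ℝ, 0 < K ∧
      ∀ (X : Type*) [MeasurableSpace X] (F : Set (X → LocalEntropy.Label)) (d n : ℕ) (h : ℝ),
        (∀ f ∈ F, Measurable f) →
        LocalEntropy.HasVCDim F d → 1 ≤ d → 0 < n →
        max C₀ (Real.sqrt ((d : ℝ) / n)) ≤ h → h ≤ C₁ →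
        LocalEntropy.IsPseudoconvex F c h →
        -- the upper bound for every ERM
        (∀ A : LocalEntropy.Learner X n, LocalEntropy.IsERM F A →
          ∀ P ∈ LocalEntropy.massart h F,
            LocalEntropy.expectedExcess P A ≤ K * LocalEntropy.upperRate F h n) ∧
        -- the lower bound for every learning algorithm
        (∀ A : LocalEntropy.Learner X n,
          ∃ P ∈ LocalEntropy.massart h F,
            K⁻¹ * LocalEntropy.lowerRate F c h d n ≤ LocalEntropy.expectedExcess P A) ∧
        -- the two bounds match
        LocalEntropy.upperRate F h n ≤ K * LocalEntropy.lowerRate F c h d n ∧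
        LocalEntropy.lowerRate F c h d n ≤ K * LocalEntropy.upperRate F h n ∧
        -- every ERM is minimax optimal up to a constant factor
        (∀ A : LocalEntropy.Learner X n, LocalEntropy.IsERM F A →
          LocalEntropy.worstExcess h F A ≤
            ENNReal.ofReal K * LocalEntropy.minimaxExcess h F n) := by
  have hC₁' : 0 < 1 - C₁ := by linarith
  have hc0 : 0 < c := by linarith
  obtain ⟨m₁, hm₁⟩ := exists_nat_ge (1 / C₀)
  obtain ⟨m₂, hm₂⟩ := exists_nat_ge (c / (1 - C₁) + 1)
  have hm₁0 : (0 : ℝ) < m₁ := lt_of_lt_of_le (by positivity) hm₁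
  have hm₂0 : (0 : ℝ) < m₂ := lt_of_lt_of_le (by positivity) hm₂
  have hm₁' : 0 < m₁ := by exact_mod_cast hm₁0
  have hm₂' : 0 < m₂ := by exact_mod_cast hm₂0
  obtain ⟨B, hB, hlower⟩ := LocalEntropy.exists_lower_bound C₀ C₁ c hC₀ hC₁ hc
  obtain ⟨k₁, hk₁, hupper⟩ := LocalEntropy.exists_upper_bound C₀ hC₀
  obtain ⟨ka, hka, hUL⟩ := LocalEntropy.exists_fixedPoint_le m₁ (m₁ * m₂) hm₁'
    (Nat.mul_pos hm₁' hm₂') C₀ hC₀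
  obtain ⟨kb, hkb, hLU⟩ := LocalEntropy.exists_fixedPoint_le m₂ (m₂ * m₁) hm₂'
    (Nat.mul_pos hm₂' hm₁') C₀ hC₀
  obtain ⟨kc, hkc, hmul⟩ := LocalEntropy.exists_fixedPoint_le 1 B one_pos hB C₀ hC₀
  obtain ⟨kd, hkd, hdim⟩ := LocalEntropy.exists_vcDim_le
  have hB0 : (0 : ℝ) < B := by exact_mod_cast hB
  set k₄ := kd / C₀ + kb with hk₄
  set k₃ := ka * (c / (1 - C₁)) with hk₃
  set k₂ := k₄ * kc * (100 * B / C₀) with hk₂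
  have hk₄0 : 0 < k₄ := by positivity
  have hk₃0 : 0 < k₃ := by positivity
  have hk₂0 : 0 < k₂ := by positivity
  -- The cube dominates each constant and also the product k₁ k₃ k₂ needed for minimax optimality.
  set K₀ := 1 + k₁ + k₂ + k₃ + k₄ with hK₀
  have hK₀1 : 1 ≤ K₀ := by linarith
  have hK₀2 : K₀ ≤ K₀ ^ 3 := le_self_pow₀ hK₀1 (by norm_num)
  have hle₁ : k₁ ≤ K₀ ^ 3 := by linarith
  have hle₂ : k₂ ≤ K₀ ^ 3 := by linarith
  have hle₃ : k₃ ≤ K₀ ^ 3 := by linarith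
  have hle₄ : k₄ ≤ K₀ ^ 3 := by linarith
  have hle : k₁ * k₃ * k₂ ≤ K₀ ^ 3 :=
    calc k₁ * k₃ * k₂ ≤ K₀ * K₀ * K₀ := by gcongr <;> linarith
      _ = K₀ ^ 3 := by ring
  clear_value k₂ k₃ K₀
  refine ⟨K₀ ^ 3, by positivity, ?_⟩
  intro X _ F d n h hmeas hVC hd hn hh hh₁ hpc
  have hhC : C₀ ≤ h := (le_max_left _ _).trans hh
  have hpos : 0 < h := hC₀.trans_le hhC
  have hlt : h < 1 := hh₁.trans_lt hC₁
  have hn0 : (0 : ℝ) < n := by exact_mod_cast hn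
  have hn1 : (1 : ℝ) ≤ n := by exact_mod_cast hn
  -- The condition √(d / n) ≤ h enters in this form: the shattered set must fit into n points.
  have hdn : d ≤ n := by
    have h1 : (d : ℝ) / n ≤ h ^ 2 := Real.sqrt_le_left hpos.le |>.1 ((le_max_right _ _).trans hh)
    have h2 : h ^ 2 ≤ 1 := by nlinarith
    rw [div_le_iff₀ hn0] at h1
    have : (d : ℝ) ≤ n := by nlinarith
    exact_mod_cast this
  have hh' : 0 < 1 - h := by linarith
  obtain ⟨hN0, hnN, hNn⟩ := LocalEntropy.ceil_bounds hC₀ hC₁ hc hm₁ hm₂ hn hhC hh₁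
  set N := ⌈n * c * h / (1 - h)⌉₊ with hN
  set Γ := LocalEntropy.fixedPoint F h 1 n with hΓ
  have hΓU : (Γ : ℝ) ≤ LocalEntropy.fixedPoint F h h n := by
    exact_mod_cast LocalEntropy.fixedPoint_anti hpos hpos hlt.le n
  have hULn := hUL X F h h N n hhC hlt.le hhC hlt.le hn hnN (by
    rw [mul_assoc]; exact Nat.mul_le_mul_left _ hNn)
  have hLUn := hLU X F h 1 n N hhC hlt.le (hhC.trans hlt.le) le_rfl hN0 hNn (by
    rw [mul_assoc]; exact Nat.mul_le_mul_left _ hnN)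
  have hmuln := hmul X F h 1 (B * n) n hhC hlt.le (hhC.trans hlt.le) le_rfl hn
    (by rw [one_mul]; exact Nat.le_mul_of_pos_left n hB) (by rw [one_mul])
  have hdimn := hdim X F h n d hpos hlt.le hVC hd hdn
  rw [← hΓ] at hmuln hdimn hLUn
  set G := LocalEntropy.fixedPoint F h 1 N with hG
  set U := LocalEntropy.upperRate F h n with hU
  set l := LocalEntropy.lowerRate F c h d n with hl
  have hUeq : U = (LocalEntropy.fixedPoint F h h n : ℝ) / n := rfl
  have hleq : l = d / (n * h) + 1 / c * ((1 - h) * (G : ℝ) / n) := rfl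
  have hΓn : (Γ : ℝ) / n ≤ U := by rw [hUeq]; gcongr
  have hU0 : 0 ≤ U := by rw [hUeq]; positivity
  have hl0 : 0 ≤ l := by
    rw [hleq]
    have : 0 ≤ (1 - h) * (G : ℝ) := mul_nonneg hh'.le (by positivity)
    positivity
  have hlΓ : l ≤ k₄ * (Γ / n) := LocalEntropy.lowerRate_le hC₀ hc hhC hlt.le hn0 hdimn hLUn
  have hUl : U ≤ k₃ * l := by
    rw [hk₃]
    exact LocalEntropy.upperRate_le hC₁ hc0 hpos hh₁ hka hn0 hULn
  have hlow : ∀ A : LocalEntropy.Learner X n, ∃ P ∈ LocalEntropy.massart h F,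
      k₂⁻¹ * l ≤ LocalEntropy.expectedExcess P A := by
    intro A
    -- The bound is at the fixed point for B n points; k₂ includes the cost kc of returning to n and
    -- the cost k₄ of passing from Γ / n to the lower rate.
    obtain ⟨P, hP, hle⟩ := hlower B le_rfl X F d n h hmeas hVC hd hn hhC hh₁ hpc A
    refine ⟨P, hP, le_trans ?_ hle⟩
    rw [inv_mul_le_iff₀ hk₂0]
    refine hlΓ.trans ?_
    calc k₄ * (Γ / n) ≤ k₄ * (kc * LocalEntropy.fixedPoint F h 1 (B * n) / n) := by gcongr
      _ = _ := by rw [hk₂]; field_simp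
  have hup : ∀ A : LocalEntropy.Learner X n, LocalEntropy.IsERM F A →
      ∀ P ∈ LocalEntropy.massart h F, LocalEntropy.expectedExcess P A ≤ k₁ * U := by
    intro A hA P hP
    refine (hupper X F n h hmeas hn hhC hlt.le A hA P hP).trans ?_
    rw [mul_div_assoc]
    gcongr
  refine ⟨fun A hA P hP => (hup A hA P hP).trans (mul_le_mul_of_nonneg_right hle₁ hU0),
    fun A => ?_, hUl.trans (mul_le_mul_of_nonneg_right hle₃ hl0), hlΓ.trans ?_, fun A hA => ?_⟩
  · obtain ⟨P, hP, hPA⟩ := hlow A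
    exact ⟨P, hP, (mul_le_mul_of_nonneg_right (inv_anti₀ hk₂0 hle₂) hl0).trans hPA⟩
  · exact (mul_le_mul_of_nonneg_left hΓn hk₄0.le).trans (mul_le_mul_of_nonneg_right hle₄ hU0)
  · refine (LocalEntropy.worstExcess_le_mul_minimaxExcess (K := k₁ * k₃) (K' := k₂) (l := l)
      (by positivity) hk₂0 A (fun P hP => ?_) hlow).trans
      (mul_le_mul_left (ENNReal.ofReal_le_ofReal hle) _)
    rw [mul_assoc]
    exact (hup A hA P hP).trans (mul_le_mul_of_nonneg_left hUl hk₁.le)
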